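/- Let $0\le s\le r\le\omega$ (integers, $\infty$ or $\omega$) and let $k,\ell\ge 0$ be integers. Let $W$ be a Hausdorff foliated manifold of dimension $k+\ell$, with $k$-dimensional leaves, of regularity $C^{r,s}$: it has an atlas with values in $\mathbb R^k\times\mathbb R^\ell$ whose transition maps are locally of the form $(x,y)\mapsto (X(x,y),Y(y))$, with $X$ of class $C^{r,s}$ and $Y$ of class $C^s$. (Class $C^{r,s}$ on an open subset of $\mathbb R^k\times\mathbb R^\ell$ means: $C^r$ in $x$ for each fixed $y$, and for every integer $i\ge 0$ with $i+s\le r$ the derivative $D_x^iX$ is of class $C^s$ in $(x,y)$; here $i+\infty=\infty$ and $i+\omega=\omega$.) Let $S\subset W$ be a solenoid, i.e. a compact subset which is a union of leaves of $W$. A flow-box of $W$ is a chart that can be added to the atlas. A flow-box of $S$ is an open set $U=\hat U\cap S$ of $S$ with a homeomorphism $\varphi:U\to D^k\times K(U)$, where $D^k$ is the open unit ball of $\mathbb R^k$ and $K(U)\subset\mathbb R^\ell$, which is the restriction of a flow-box $\hat U\to \mathbb R^k\times\mathbb R^\ell$ of $W$ and is such that the closure $\overline U$ is contained in the domain of some flow-box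 of $W$ extending $\varphi$. A local transversal of $S$ is a non-empty set $T=\varphi^{-1}(\{0\}\times K(U))$, for some flow-box $(U,\varphi)$ of $S$. A path contained in a leaf, from a point $p_1$ of a local transversal $T_1$ to a point $p_2$ of a local transversal $T_2$, defines, by lifting it continuously to nearby leaves, a holonomy germ $(T_1,p_1)\to(T_2,p_2)$. A holonomy map $h:V\subset T_1\to T_2$ is a homeomorphism from an open set $V\subset T_1$ onto an open subset $h(V)$ of $T_2$ whose germ at every point of $V$ is such a germ; the holonomy maps from $T$ to $T$ form the holonomy pseudo-group of $T$. A transversal measure on $S$ is a family $\mu=(\mu_T)$ of locally finite positive Borel measures $\mu_T$ on $T$, one for each local transversal $T$ of $S$, not all zero, such that $h_*(\mu_{T_1}|_V)=\mu_{T_2}|_{h(V)}$ for all holonomy maps $h:V\subset T_1\to T_2$. Let $\mathcal M_{\mathcal T}(S)$ be the set of transversal measures on $S$. A transversal measure $\mu$ is ergodic if, for every local transversal $T$ and every Borel set $A\subset T$ invariant by the holonomy pseudo-group of $T$, either $\mu_T(A)=0$ or $\mu_T(A)=\mu_T(T)$. If $\mathcal M_{\mathcal T}(S)$ is non-empty,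 then $\mathcal M_{\mathcal T}(S)$ contains an ergodic transversal measure. -/

import Mathlib

open Set Filter Topology MeasureTheory
open scoped unitInterval

noncomputable section

namespace Solenoid

/-- The Euclidean space `ℝ^n`. -/
abbrev E (n : ℕ) : Type := EuclideanSpace ℝ (Fin n)

/-- The model space `ℝ^k × ℝ^ℓ` (leaf coordinate, transversal coordinate). -/
abbrev Model (k l : ℕ) : Type := E k × E l

/-- Class `C^{r,s}` (`s ≤ r ≤ ω`) on an open set `O ⊆ ℝ^k × ℝ^ℓ`: leafwise (in `x`) the map is
`C^r`, and each leafwise derivative `D_x^i f` with `i + s ≤ r` is jointly of class `C^s`.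
(For finite `r` this says that the mixed derivatives `D_x^i D_y^j f` with `j ≤ s`, `i + j ≤ r`
exist and are continuous.) -/
def IsOfClass {k l : ℕ} {F : Type*} [NormedAddCommGroup F] [NormedSpace ℝ F]
    (r s : WithTop ℕ∞) (f : Model k l → F) (O : Set (Model k l)) : Prop :=
  (∀ y : E l, ContDiffOn ℝ r (fun x : E k => f (x, y)) {x | (x, y) ∈ O}) ∧
  ∀ i : ℕ, (i : WithTop ℕ∞) + s ≤ r →
    ContDiffOn ℝ s
      (fun z : Model k l => iteratedFDeriv ℝ i (fun x : E k => f (x, z.2)) z.1) O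

/-- A local homeomorphism of `ℝ^k × ℝ^ℓ` is a foliated transition map of class `C^{r,s}` if it is
locally of the form `(x, y) ↦ (X (x, y), Y y)` with `X` of class `C^{r,s}` and `Y` of
class `C^s`. -/
def IsFoliatedTransition {k l : ℕ} (r s : WithTop ℕ∞)
    (f : OpenPartialHomeomorph (Model k l) (Model k l)) : Prop :=
  ∀ z ∈ f.source, ∃ O : Set (Model k l), IsOpen O ∧ z ∈ O ∧ O ⊆ f.source ∧
    ∃ (X : Model k l → E k) (Y : E l → E l),
      IsOfClass r s X O ∧ ContDiffOn ℝ s Y (Prod.snd '' O) ∧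
      ∀ w ∈ O, f w = (X w, Y w.2)

/-- A foliated manifold of dimension `k + ℓ`, with `k`-dimensional leaves, of regularity
`C^{r,s}`: the given atlas has foliated transition maps of class `C^{r,s}`. -/
class IsFoliatedManifold (k l : ℕ) (r s : WithTop ℕ∞) (W : Type*) [TopologicalSpace W]
    [ChartedSpace (Model k l) W] : Prop where
  transition : ∀ e ∈ atlas (Model k l) W, ∀ e' ∈ atlas (Model k l) W,
    IsFoliatedTransition r s (e.symm.trans e')

section Topological

variable (k l : ℕ) (r s : WithTop ℕ∞) {W : Type*} [TopologicalSpace W]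
  [ChartedSpace (Model k l) W]

/-- A flow-box of the foliated manifold `W`: a chart which may be added to the atlas. -/
def IsFlowBox (φ : OpenPartialHomeomorph W (Model k l)) : Prop :=
  ∀ e ∈ atlas (Model k l) W,
    IsFoliatedTransition r s (e.symm.trans φ) ∧ IsFoliatedTransition r s (φ.symm.trans e)

/-- A path contained in a leaf: it is continuous, and its transversal coordinate is locally
constant in every chart (that is, it is a continuous path for the leaf topology). -/
def IsLeafPath (γ : I → W) : Prop :=
  Continuous γ ∧ ∀ e ∈ atlas (Model k l) W, ∀ t : I, γ t ∈ e.source →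
    ∀ᶠ t' in 𝓝 t, (e (γ t')).2 = (e (γ t)).2

/-- The leaf through `p`. -/
def leaf (p : W) : Set W :=
  {q | ∃ γ : I → W, IsLeafPath k l γ ∧ γ 0 = p ∧ γ 1 = q}

/-- `(S, W)` is a pre-solenoid: `S ⊆ W` is compact and a union of leaves. -/
structure IsPreSolenoid (S : Set W) : Prop where
  isCompact : IsCompact S
  leaf_subset : ∀ p ∈ S, leaf k l p ⊆ S

/-- A (good) flow-box of the solenoid `S ⊆ W`: the set `U = Û ∩ S` together with the restriction
to `U` of a flow-box `Û → ℝ^k × ℝ^ℓ` of `W` that maps `U` onto `D^k × K`, where `D^k` is the open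
unit ball; it is good in that the closure of `U` lies in the domain of a larger flow-box that
extends the coordinates on `U` (so the closure of `U` becomes the compact set
`closedBall × closure K`). -/
structure FlowBox (S : Set W) where
  chart : OpenPartialHomeomorph W (Model k l)
  isFlowBox : IsFlowBox k l r s chart
  K : Set (E l)
  image_eq : chart '' (chart.source ∩ S) = Metric.ball (0 : E k) 1 ×ˢ K
  good : ∃ chart' : OpenPartialHomeomorph W (Model k l), IsFlowBox k l r s chart' ∧
    closure (chart.source ∩ S) ⊆ chart'.source ∧ EqOn chart' chart (chart.source ∩ S)

/-- `T` is a local transversal of `S` at `p`: it is the slice `φ⁻¹({0} × K)` of a flow-box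
`(U, φ)` of `S`, and `p ∈ T`. (So `U` is a neighbourhood of `p` in `S`.) -/
def IsLocalTransversalAt (S T : Set W) (p : W) : Prop :=
  p ∈ T ∧ ∃ B : FlowBox k l r s S, T ⊆ B.chart.source ∩ S ∧
    B.chart '' T = ({0} : Set (E k)) ×ˢ B.K

/-- The local transversals of `S`. -/
def LocalTransversal (S : Set W) : Type _ :=
  {T : Set W // ∃ p, IsLocalTransversalAt k l r s S T p}

/-- A map `h : T₁ → T₂` has at `p` the germ of the holonomy along `γ`: the path `γ`, which starts
at `p`, lifts continuously to paths in the nearby leaves, which lead from the points `q ∈ T₁`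
near `p` to the points `h q ∈ T₂`. -/
def HasHolonomyGerm {T₁ T₂ : Set W} (γ : I → W) (h : T₁ → T₂) (p : T₁) : Prop :=
  ∃ N ∈ 𝓝 p, ∃ H : T₁ → I → W,
    ContinuousOn (Function.uncurry H) (N ×ˢ (univ : Set I)) ∧ H p = γ ∧
    ∀ q ∈ N, IsLeafPath k l (H q) ∧ H q 0 = (q : W) ∧ H q 1 = (h q : W)

/-- The holonomy maps `V ⊆ T₁ → T₂`: homeomorphisms of an open subset of `T₁` onto an open subset
of `T₂` whose germ at each point is the holonomy along some path contained in a leaf. For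
`T₁ = T₂ = T` these form the holonomy pseudo-group of `T`. -/
def IsHolonomyMap {T₁ T₂ : Set W} (h : OpenPartialHomeomorph T₁ T₂) : Prop :=
  ∀ p ∈ h.source, ∃ γ : I → W, IsLeafPath k l γ ∧ γ 0 = (p : W) ∧ γ 1 = (h p : W) ∧
    HasHolonomyGerm k l γ h p

end Topological

section Measurable

variable (k l : ℕ) (r s : WithTop ℕ∞) {W : Type*} [TopologicalSpace W]
  [ChartedSpace (Model k l) W] [MeasurableSpace W]

/-- The space `M_T(S)` of transversal measures of `S`: the families `(μ_T)` of locally finite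
(positive, Borel) measures on the local transversals `T` of `S` that are invariant under all
holonomy maps and are not all zero. -/
def transversalMeasures (S : Set W) :
    Set ((T : LocalTransversal k l r s S) → Measure T.1) :=
  {μ | (∀ T, IsLocallyFiniteMeasure (μ T)) ∧
    (∀ (T₁ T₂ : LocalTransversal k l r s S) (h : OpenPartialHomeomorph T₁.1 T₂.1),
      IsHolonomyMap k l h →
        ((μ T₁).restrict h.source).map h = (μ T₂).restrict h.target) ∧
    ∃ T, μ T ≠ 0}

/-- Transverse ergodicity: each Borel subset `A` of a local transversal `T` which is invariant by
the holonomy pseudo-group of `T` has `μ_T(A) = 0` or `μ_T(A) = μ_T(T)`. -/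
def IsErgodic {S : Set W} (μ : (T : LocalTransversal k l r s S) → Measure T.1) : Prop :=
  ∀ (T : LocalTransversal k l r s S) (A : Set T.1), MeasurableSet A →
    (∀ h : OpenPartialHomeomorph T.1 T.1, IsHolonomyMap k l h →
      ∀ x ∈ h.source, h x ∈ A ↔ x ∈ A) →
    μ T A = 0 ∨ μ T A = μ T univ

end Measurable

end Solenoid

end

/-!
The proof splits into a theorem about pseudo-groups and a geometric part.

*Pseudo-groups.* Consider locally compact spaces `X i` and a pseudo-group of partial homeomorphisms
between them which is compactly generated: finitely many non-negative test functions are such that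
each point can be moved by the pseudo-group to a point where one of them is positive
(`IsGenerating`). An invariant family of measures is the same as a family of positive functionals on
the spaces `C_c(X i, ℝ)` that is invariant under pull-back (`exists_integralFunctional_eq`, from the
Riesz–Markov–Kakutani theorem). The invariant functionals for which the integrals of the generating
test functions sum to one form a closed subset of a product of lines, and it is bounded in each
coordinate, because the generating functions control the measure of every compact set
(`IsGenerating.exists_measure_le`). So it is compact, and by the Krein–Milman theorem it has an
extreme point. Extreme points are ergodic (`ergodic_of_mem_extremePoints`): an invariant Borel set
of one `X i` has a Borel saturation in all of them, and cutting the measures along the saturation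
would otherwise write the extreme point as a proper convex combination.

*Geometry.* The local transversals of a solenoid are locally compact and second countable, and the
holonomy maps between them form a pseudo-group (`isPseudogroup_holonomy`). Compact generation
(`IsPreSolenoid.exists_isGenerating`) comes from the compactness of `S`: every point of `S` is the
centre of a flow-box (`IsPreSolenoid.exists_flowBox`), and a point of any local transversal that
lies in a flow-box `U` is moved to the transversal of `U` by sliding along the plaques of `U`, which
is a holonomy map (`exists_holonomyMap_slide`).
-/

noncomputable section

namespace Solenoid

open scoped CompactlySupported ENNReal

/-! ### Transport of measures by partial homeomorphisms -/

section Transport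

variable {X Y : Type*} [TopologicalSpace X] [TopologicalSpace Y]

/-- `f` is the pull-back of `g` by the partial homeomorphism `h`, extended by zero. -/
structure IsPullback (h : OpenPartialHomeomorph X Y) (f : C_c(X, ℝ)) (g : C_c(Y, ℝ)) : Prop where
  eqOn : ∀ x ∈ h.source, f x = g (h x)
  eq_zero_left : ∀ x ∉ h.source, f x = 0
  eq_zero_right : ∀ y ∉ h.target, g y = 0

lemma IsPullback.symm {h : OpenPartialHomeomorph X Y} {f : C_c(X, ℝ)} {g : C_c(Y, ℝ)}
    (H : IsPullback h f g) : IsPullback h.symm g f where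
  eqOn y hy := by rw [H.eqOn _ (h.map_target hy), h.right_inv hy]
  eq_zero_left := H.eq_zero_right
  eq_zero_right := H.eq_zero_left

/-- A compactly supported function on the target whose support lies in `h.target` can be pulled
back: outside a compact subset of `h.source` the pull-back vanishes. -/
lemma exists_isPullback [T2Space X] (h : OpenPartialHomeomorph X Y) (g : C_c(Y, ℝ))
    (hg : tsupport g ⊆ h.target) : ∃ f : C_c(X, ℝ), IsPullback h f g := by
  classical
  set G := h.symm '' tsupport g with hG
  have hGc : IsCompact G := g.hasCompactSupport.isCompact.image_of_continuousOn
    (h.continuousOn_symm.mono hg)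
  have hGs : G ⊆ h.source := by
    rintro _ ⟨y, hy, rfl⟩
    exact h.map_target (hg hy)
  have hz : ∀ x ∉ G, h.source.indicator (fun x => g (h x)) x = 0 := by
    intro x hx
    by_cases hs : x ∈ h.source
    · rw [indicator_of_mem hs]
      by_contra hne
      exact hx ⟨h x, subset_tsupport _ hne, h.left_inv hs⟩
    · exact indicator_of_notMem hs _
  have hcont : Continuous (h.source.indicator (fun x => g (h x))) := by
    rw [continuous_iff_continuousAt]
    intro x
    by_cases hx : x ∈ h.source
    · have h1 : ContinuousAt (fun x => g (h x)) x :=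
        g.continuous.continuousAt.comp (h.continuousAt hx)
      refine h1.congr ?_
      filter_upwards [h.open_source.mem_nhds hx] with z hz
      rw [indicator_of_mem hz]
    · have hx' : x ∈ Gᶜ := fun hh => hx (hGs hh)
      refine (continuousAt_const (y := (0 : ℝ))).congr ?_
      filter_upwards [hGc.isClosed.isOpen_compl.mem_nhds hx'] with z hz'
      exact (hz z hz').symm
  refine ⟨⟨⟨_, hcont⟩, HasCompactSupport.intro hGc hz⟩, ?_, ?_, ?_⟩
  · intro x hx
    exact indicator_of_mem hx (fun x => g (h x))
  · intro x hx
    exact indicator_of_notMem hx (fun x => g (h x))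
  · intro y hy
    exact image_eq_zero_of_notMem_tsupport fun hh => hy (hg hh)

variable [MeasurableSpace X] [BorelSpace X] [MeasurableSpace Y] [BorelSpace Y]

lemma aemeasurable_restrict_source (h : OpenPartialHomeomorph X Y) (μ : Measure X) :
    AEMeasurable h (μ.restrict h.source) :=
  h.continuousOn.aemeasurable h.open_source.measurableSet

lemma map_restrict_source_apply (h : OpenPartialHomeomorph X Y) (μ : Measure X) {B : Set Y}
    (hB : MeasurableSet B) :
    (μ.restrict h.source).map h B = μ (h.source ∩ h ⁻¹' B) := by
  rw [Measure.map_apply_of_aemeasurable (aemeasurable_restrict_source h μ) hB,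
    Measure.restrict_apply' h.open_source.measurableSet, inter_comm]

lemma IsPullback.integral_eq {h : OpenPartialHomeomorph X Y} {f : C_c(X, ℝ)} {g : C_c(Y, ℝ)}
    (H : IsPullback h f g) {μ : Measure X} {ν : Measure Y}
    (hμν : (μ.restrict h.source).map h = ν.restrict h.target) :
    ∫ x, f x ∂μ = ∫ y, g y ∂ν := by
  rw [← setIntegral_eq_integral_of_forall_compl_eq_zero (s := h.source) H.eq_zero_left,
    ← setIntegral_eq_integral_of_forall_compl_eq_zero (s := h.target) H.eq_zero_right, ← hμν,
    integral_map (f := g) (aemeasurable_restrict_source h μ)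
      g.continuous.measurable.aestronglyMeasurable]
  exact setIntegral_congr_fun h.open_source.measurableSet H.eqOn

/-- If pulling back by `h` preserves the integrals of test functions, then `h` does not decrease
the measure of open sets: this is Urysohn's lemma together with inner regularity. -/
lemma measure_le_of_integral_eq [T2Space X] [T2Space Y] [LocallyCompactSpace Y]
    (h : OpenPartialHomeomorph X Y) {μ : Measure X} {ν : Measure Y}
    [IsFiniteMeasureOnCompacts μ] [ν.Regular]
    (hμν : ∀ f g, IsPullback h f g → ∫ x, f x ∂μ = ∫ y, g y ∂ν)
    {O : Set Y} (hO : IsOpen O) (hOt : O ⊆ h.target) :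
    ν O ≤ μ (h.source ∩ h ⁻¹' O) := by
  rw [hO.measure_eq_iSup_isCompact]
  refine iSup_le fun G => iSup_le fun hGO => iSup_le fun hG => ?_
  obtain ⟨g, hg1, hgc, hgO, hgI⟩ := exists_continuousMap_one_of_isCompact_subset_isOpen hG hO hGO
  let g' : C_c(Y, ℝ) := ⟨g, hgc⟩
  obtain ⟨f, hf⟩ := exists_isPullback h g' (hgO.trans hOt)
  have hg0 : ∀ y, 0 ≤ g' y := fun y => (hgI y).1
  have hf01 : ∀ x, 0 ≤ f x ∧ ENNReal.ofReal (f x) ≤ (h.source ∩ h ⁻¹' O).indicator 1 x := by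
    intro x
    by_cases hx : x ∈ h.source
    · rw [hf.eqOn x hx]
      refine ⟨hg0 _, ?_⟩
      by_cases hxO : h x ∈ O
      · rw [indicator_of_mem (show x ∈ h.source ∩ h ⁻¹' O from ⟨hx, hxO⟩)]
        exact ENNReal.ofReal_le_one.2 (hgI (h x)).2
      · have : g' (h x) = 0 := image_eq_zero_of_notMem_tsupport fun hh => hxO (hgO hh)
        simp [this]
    · simp [hf.eq_zero_left x hx]
  have hm : MeasurableSet (h.source ∩ h ⁻¹' O) :=
    (h.isOpen_inter_preimage hO).measurableSet
  calc ν G = ∫⁻ y, G.indicator 1 y ∂ν := by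
        rw [lintegral_indicator_one hG.measurableSet]
    _ ≤ ∫⁻ y, ENNReal.ofReal (g' y) ∂ν := by
        refine lintegral_mono fun y => ?_
        by_cases hy : y ∈ G
        · have : g' y = 1 := hg1 hy
          simp [hy, this]
        · simp [hy]
    _ = ENNReal.ofReal (∫ x, f x ∂μ) := by
        rw [hμν f g' hf, ofReal_integral_eq_lintegral_ofReal g'.integrable (ae_of_all _ hg0)]
    _ = ∫⁻ x, ENNReal.ofReal (f x) ∂μ :=
        ofReal_integral_eq_lintegral_ofReal f.integrable (ae_of_all _ fun x => (hf01 x).1)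
    _ ≤ ∫⁻ x, (h.source ∩ h ⁻¹' O).indicator 1 x ∂μ := lintegral_mono fun x => (hf01 x).2
    _ = μ (h.source ∩ h ⁻¹' O) := lintegral_indicator_one hm

/-- Invariance under `h` can be tested on integrals of compactly supported functions. The two
measures are shown to agree on open sets; this suffices because `ν.restrict h.target` is locally
finite on all of `Y`, even though the push-forward of `μ` is not known to be so near the boundary
of `h.target`. -/
lemma map_restrict_eq_of_integral_eq [T2Space X] [T2Space Y] [LocallyCompactSpace X]
    [LocallyCompactSpace Y] [SecondCountableTopology Y]
    (h : OpenPartialHomeomorph X Y) {μ : Measure X} {ν : Measure Y} [μ.Regular] [ν.Regular]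
    (hμν : ∀ f g, IsPullback h f g → ∫ x, f x ∂μ = ∫ y, g y ∂ν) :
    (μ.restrict h.source).map h = ν.restrict h.target := by
  have hopen : ∀ O : Set Y, IsOpen O → ν.restrict h.target O = (μ.restrict h.source).map h O := by
    intro O hO
    have hO' : IsOpen (O ∩ h.target) := hO.inter h.open_target
    have hpre : h.source ∩ h ⁻¹' (O ∩ h.target) = h.source ∩ h ⁻¹' O := by
      ext x
      constructor
      · rintro ⟨hx, hx', -⟩
        exact ⟨hx, hx'⟩
      · rintro ⟨hx, hx'⟩
        exact ⟨hx, hx', h.map_source hx⟩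
    rw [map_restrict_source_apply h μ hO.measurableSet,
      Measure.restrict_apply' h.open_target.measurableSet, ← hpre]
    apply le_antisymm
    · exact measure_le_of_integral_eq h hμν hO' inter_subset_right
    · refine (measure_le_of_integral_eq h.symm
        (fun f g H => (hμν g f H.symm).symm) (h.isOpen_inter_preimage hO')
        inter_subset_left).trans (measure_mono ?_)
      rintro y ⟨hy, -, hy'⟩
      rw [mem_preimage, h.right_inv hy] at hy'
      exact hy'
  refine (((ν.restrict h.target).finiteSpanningSetsInOpen').ext ?_ ?_ hopen).symm
  · exact BorelSpace.measurable_eq.trans rfl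
  · exact isPiSystem_isOpen

end Transport

/-! ### Invariant measures and invariant functionals of a system of spaces -/

section System

variable {ι : Type*} {X : ι → Type*} [∀ i, TopologicalSpace (X i)]

/-- The pairs of an index `i` and a test function on `X i`. -/
abbrev Test (X : ι → Type*) [∀ i, TopologicalSpace (X i)] : Type _ := Σ i, C_c(X i, ℝ)

/-- A pseudo-group of partial homeomorphisms between the spaces `X i`, as far as the argument
needs it: a family containing the identities and closed under inverses and compositions. -/
structure IsPseudogroup (Hol : ∀ i j, Set (OpenPartialHomeomorph (X i) (X j))) : Prop where
  refl : ∀ i, OpenPartialHomeomorph.refl (X i) ∈ Hol i i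
  symm : ∀ {i j}, ∀ h ∈ Hol i j, h.symm ∈ Hol j i
  trans : ∀ {i j m}, ∀ h ∈ Hol i j, ∀ h' ∈ Hol j m, h.trans h' ∈ Hol i m

/-- A finite set `Q` of non-negative test functions is generating if each point of each `X i` can
be moved by the pseudo-group to a point at which a member of `Q` is positive. The sum of the
integrals of the members of `Q` then controls invariant families of measures. -/
structure IsGenerating (Hol : ∀ i j, Set (OpenPartialHomeomorph (X i) (X j)))
    (Q : Finset (Test X)) : Prop where
  nonneg : ∀ q ∈ Q, ∀ x, 0 ≤ q.2 x
  exists_pos : ∀ i (x : X i), ∃ q ∈ Q, ∃ h ∈ Hol i q.1, x ∈ h.source ∧ 0 < q.2 (h x)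

/-- The closed convex cone of families of invariant positive linear functionals, inside the
product space of all functions on `Test X`. -/
def invariantCone (Hol : ∀ i j, Set (OpenPartialHomeomorph (X i) (X j))) : Set (Test X → ℝ) :=
  {Λ | (∀ i (f g : C_c(X i, ℝ)), Λ ⟨i, f + g⟩ = Λ ⟨i, f⟩ + Λ ⟨i, g⟩) ∧
    (∀ i (c : ℝ) (f : C_c(X i, ℝ)), Λ ⟨i, c • f⟩ = c * Λ ⟨i, f⟩) ∧
    (∀ i (f : C_c(X i, ℝ)), 0 ≤ f → 0 ≤ Λ ⟨i, f⟩) ∧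
    ∀ i j (f : C_c(X i, ℝ)) (g : C_c(X j, ℝ)), (∃ h ∈ Hol i j, IsPullback h f g) →
      Λ ⟨i, f⟩ = Λ ⟨j, g⟩}

/-- The members of the invariant cone that give the generating set `Q` total mass one. -/
def normalizedCone (Hol : ∀ i j, Set (OpenPartialHomeomorph (X i) (X j)))
    (Q : Finset (Test X)) : Set (Test X → ℝ) :=
  invariantCone Hol ∩ {Λ | ∑ q ∈ Q, Λ q = 1}

lemma isClosed_normalizedCone (Hol : ∀ i j, Set (OpenPartialHomeomorph (X i) (X j)))
    (Q : Finset (Test X)) : IsClosed (normalizedCone Hol Q) := by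
  refine IsClosed.inter ?_ (isClosed_eq (by fun_prop) continuous_const)
  simp only [invariantCone, ofPred_and, ofPred_forall]
  refine IsClosed.inter ?_ (IsClosed.inter ?_ (IsClosed.inter ?_ ?_))
  · exact isClosed_iInter fun i => isClosed_iInter fun f => isClosed_iInter fun g =>
      isClosed_eq (by fun_prop) (by fun_prop)
  · exact isClosed_iInter fun i => isClosed_iInter fun f => isClosed_iInter fun g =>
      isClosed_eq (by fun_prop) (by fun_prop)
  · exact isClosed_iInter fun i => isClosed_iInter fun f => isClosed_iInter fun _ =>
      isClosed_le (by fun_prop) (by fun_prop)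
  · exact isClosed_iInter fun i => isClosed_iInter fun j => isClosed_iInter fun f =>
      isClosed_iInter fun g => isClosed_iInter fun _ => isClosed_eq (by fun_prop) (by fun_prop)

lemma smul_mem_invariantCone {Hol : ∀ i j, Set (OpenPartialHomeomorph (X i) (X j))}
    {Λ : Test X → ℝ} (hΛ : Λ ∈ invariantCone Hol) {c : ℝ} (hc : 0 ≤ c) :
    c • Λ ∈ invariantCone Hol := by
  obtain ⟨h1, h2, h3, h4⟩ := hΛ
  refine ⟨fun i f g => ?_, fun i a f => ?_, fun i f hf => ?_, fun i j f g hfg => ?_⟩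
  · simp [h1, mul_add]
  · simp [h2, mul_left_comm]
  · exact mul_nonneg hc (h3 i f hf)
  · simp [h4 i j f g hfg]

variable [∀ i, MeasurableSpace (X i)]

/-- Invariance of a family of measures under the pseudo-group. -/
def IsInvariant (Hol : ∀ i j, Set (OpenPartialHomeomorph (X i) (X j)))
    (μ : ∀ i, Measure (X i)) : Prop :=
  ∀ i j, ∀ h ∈ Hol i j, ((μ i).restrict h.source).map h = (μ j).restrict h.target

/-- Integration against a family of measures. -/
def integralFunctional (μ : ∀ i, Measure (X i)) : Test X → ℝ := fun q => ∫ x, q.2 x ∂(μ q.1)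

variable [∀ i, BorelSpace (X i)] {Hol : ∀ i j, Set (OpenPartialHomeomorph (X i) (X j))}
  {Q : Finset (Test X)}

lemma integralFunctional_mem_invariantCone {μ : ∀ i, Measure (X i)}
    [∀ i, IsLocallyFiniteMeasure (μ i)] (hμ : IsInvariant Hol μ) :
    integralFunctional μ ∈ invariantCone Hol := by
  refine ⟨fun i f g => ?_, fun i c f => ?_, fun i f hf => ?_, fun i j f g hfg => ?_⟩
  · exact integral_add f.integrable g.integrable
  · exact integral_const_mul c _
  · exact integral_nonneg hf
  · obtain ⟨h, hh, H⟩ := hfg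
    exact H.integral_eq (hμ i j h hh)

/-- By the Riesz–Markov–Kakutani theorem, each member of the invariant cone is the integral against
an invariant family of measures. -/
lemma exists_integralFunctional_eq [∀ i, T2Space (X i)] [∀ i, LocallyCompactSpace (X i)]
    [∀ i, SecondCountableTopology (X i)] {Λ : Test X → ℝ} (hΛ : Λ ∈ invariantCone Hol) :
    ∃ μ : ∀ i, Measure (X i), (∀ i, IsLocallyFiniteMeasure (μ i)) ∧ IsInvariant Hol μ ∧
      integralFunctional μ = Λ := by
  obtain ⟨h1, h2, h3, h4⟩ := hΛ
  let L : ∀ i, C_c(X i, ℝ) →ₚ[ℝ] ℝ := fun i =>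
    PositiveLinearMap.mk₀ ⟨⟨fun f => Λ ⟨i, f⟩, h1 i⟩, h2 i⟩ (h3 i)
  have hL : ∀ i (f : C_c(X i, ℝ)), ∫ x, f x ∂(RealRMK.rieszMeasure (L i)) = Λ ⟨i, f⟩ :=
    fun i f => RealRMK.integral_rieszMeasure (L i) f
  refine ⟨fun i => RealRMK.rieszMeasure (L i), fun i => inferInstance, ?_, ?_⟩
  · intro i j h hh
    refine map_restrict_eq_of_integral_eq h fun f g hfg => ?_
    rw [hL, hL, h4 i j f g ⟨h, hh, hfg⟩]
  · funext q
    exact hL q.1 q.2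

lemma IsInvariant.measure_eq {μ : ∀ i, Measure (X i)} (hμ : IsInvariant Hol μ) {i j : ι}
    {h : OpenPartialHomeomorph (X i) (X j)} (hh : h ∈ Hol i j) {B : Set (X j)}
    (hB : MeasurableSet B) : μ i (h.source ∩ h ⁻¹' B) = μ j (B ∩ h.target) := by
  rw [← map_restrict_source_apply h (μ i) hB, hμ i j h hh,
    Measure.restrict_apply' h.open_target.measurableSet]

/-- Each point has a neighbourhood whose measure is controlled by the mass of `Q`, with a constant
that does not depend on the invariant family. -/
lemma IsGenerating.exists_nhds_measure_le (hQ : IsGenerating Hol Q) (i : ι) (x : X i) :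
    ∃ V ∈ 𝓝 x, ∃ c : ℝ, ∀ μ : ∀ i, Measure (X i), (∀ i, IsLocallyFiniteMeasure (μ i)) →
      IsInvariant Hol μ → μ i V ≤ ENNReal.ofReal (c * ∑ q ∈ Q, integralFunctional μ q) := by
  obtain ⟨q, hq, h, hh, hx, hpos⟩ := hQ.exists_pos i x
  -- `h` moves a neighbourhood of `x` into `{q > ε}`, where Markov's inequality applies
  set ε := q.2 (h x) / 2 with hε
  have hε0 : 0 < ε := half_pos hpos
  have hO : IsOpen {y | ε < q.2 y} := isOpen_lt continuous_const q.2.continuous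
  refine ⟨h.source ∩ h ⁻¹' {y | ε < q.2 y},
    (h.isOpen_inter_preimage hO).mem_nhds ⟨hx, half_lt_self hpos⟩, ε⁻¹, fun μ hlf hμ => ?_⟩
  have hint : Integrable q.2 (μ q.1) := q.2.integrable
  have hnn : ∀ p ∈ Q, 0 ≤ integralFunctional μ p := fun p hp => integral_nonneg (hQ.nonneg p hp)
  have hle := mul_meas_ge_le_integral_of_nonneg (ae_of_all _ (hQ.nonneg q hq)) hint ε
  have hfin : μ q.1 {y | ε ≤ q.2 y} < ∞ := hint.measure_ge_lt_top hε0
  calc μ i (h.source ∩ h ⁻¹' {y | ε < q.2 y}) ≤ μ q.1 {y | ε ≤ q.2 y} := by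
        rw [hμ.measure_eq hh hO.measurableSet]
        refine measure_mono ?_
        rintro y ⟨hy, -⟩
        rw [mem_ofPred_eq] at hy ⊢
        exact hy.le
    _ = ENNReal.ofReal ((μ q.1).real {y | ε ≤ q.2 y}) := (ofReal_measureReal hfin.ne).symm
    _ ≤ _ := by
        refine ENNReal.ofReal_le_ofReal ?_
        rw [inv_mul_eq_div, le_div_iff₀ hε0, mul_comm]
        exact hle.trans (Finset.single_le_sum hnn hq)

lemma IsGenerating.exists_measure_le (hQ : IsGenerating Hol Q) (i : ι) {G : Set (X i)}
    (hG : IsCompact G) :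
    ∃ c : ℝ, 0 ≤ c ∧ ∀ μ : ∀ i, Measure (X i), (∀ i, IsLocallyFiniteMeasure (μ i)) →
      IsInvariant Hol μ → μ i G ≤ ENNReal.ofReal (c * ∑ q ∈ Q, integralFunctional μ q) := by
  have hnn : ∀ μ : ∀ i, Measure (X i), 0 ≤ ∑ q ∈ Q, integralFunctional μ q := fun μ =>
    Finset.sum_nonneg fun p hp => integral_nonneg (hQ.nonneg p hp)
  refine hG.induction_on ⟨0, le_rfl, by simp⟩ ?_ ?_ fun x _ => ?_
  · rintro s t hst ⟨c, hc, H⟩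
    exact ⟨c, hc, fun μ h1 h2 => (measure_mono hst).trans (H μ h1 h2)⟩
  · rintro s t ⟨c, hc, H⟩ ⟨d, hd, H'⟩
    refine ⟨c + d, add_nonneg hc hd, fun μ h1 h2 => (measure_union_le _ _).trans ?_⟩
    rw [add_mul, ENNReal.ofReal_add (mul_nonneg hc (hnn μ)) (mul_nonneg hd (hnn μ))]
    exact add_le_add (H μ h1 h2) (H' μ h1 h2)
  · obtain ⟨V, hV, c, H⟩ := hQ.exists_nhds_measure_le i x
    refine ⟨V, mem_nhdsWithin_of_mem_nhds hV, max c 0, le_max_right _ _, fun μ h1 h2 => ?_⟩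
    exact (H μ h1 h2).trans (ENNReal.ofReal_le_ofReal
      (mul_le_mul_of_nonneg_right (le_max_left _ _) (hnn μ)))

/-- An invariant family that gives `Q` no mass is zero. -/
lemma IsGenerating.eq_zero [∀ i, SecondCountableTopology (X i)] (hQ : IsGenerating Hol Q)
    {μ : ∀ i, Measure (X i)} [∀ i, IsLocallyFiniteMeasure (μ i)] (hμ : IsInvariant Hol μ)
    (h0 : ∑ q ∈ Q, integralFunctional μ q = 0) (i : ι) : μ i = 0 := by
  rw [← Measure.measure_univ_eq_zero]
  refine measure_null_of_locally_null _ fun x _ => ?_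
  obtain ⟨V, hV, c, H⟩ := hQ.exists_nhds_measure_le i x
  refine ⟨V, mem_nhdsWithin_of_mem_nhds hV, ?_⟩
  simpa [h0] using H μ inferInstance hμ

lemma IsGenerating.sum_pos [∀ i, SecondCountableTopology (X i)] (hQ : IsGenerating Hol Q)
    {μ : ∀ i, Measure (X i)} [∀ i, IsLocallyFiniteMeasure (μ i)] (hμ : IsInvariant Hol μ)
    {i : ι} (hi : μ i ≠ 0) : 0 < ∑ q ∈ Q, integralFunctional μ q :=
  (Finset.sum_nonneg fun p hp => integral_nonneg (hQ.nonneg p hp)).lt_of_ne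
    fun h0 => hi (hQ.eq_zero hμ h0.symm i)

lemma inv_smul_mem_normalizedCone {μ : ∀ i, Measure (X i)} [∀ i, IsLocallyFiniteMeasure (μ i)]
    (hμ : IsInvariant Hol μ) (hpos : 0 < ∑ q ∈ Q, integralFunctional μ q) :
    (∑ q ∈ Q, integralFunctional μ q)⁻¹ • integralFunctional μ ∈ normalizedCone Hol Q := by
  refine ⟨smul_mem_invariantCone (integralFunctional_mem_invariantCone hμ) (inv_nonneg.2 hpos.le),
    ?_⟩
  simp only [Pi.smul_apply, smul_eq_mul, mem_ofPred_eq, ← Finset.mul_sum]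
  exact inv_mul_cancel₀ hpos.ne'

/-- Compactness in the product topology: the value at a test function `f` is bounded by a constant
that depends only on `f`. -/
lemma IsGenerating.isCompact_normalizedCone [∀ i, T2Space (X i)] [∀ i, LocallyCompactSpace (X i)]
    [∀ i, SecondCountableTopology (X i)] (hQ : IsGenerating Hol Q) :
    IsCompact (normalizedCone Hol Q) := by
  have hbound : ∀ q : Test X, ∃ c : ℝ, ∀ Λ ∈ normalizedCone Hol Q, Λ q ∈ Icc (-c) c := by
    intro q
    obtain ⟨c, hc, H⟩ := hQ.exists_measure_le q.1 q.2.hasCompactSupport.isCompact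
    obtain ⟨M, hM⟩ := q.2.continuous.bounded_above_of_compact_support q.2.hasCompactSupport
    refine ⟨max M 0 * c, fun Λ hΛ => ?_⟩
    obtain ⟨μ, hlf, hμ, rfl⟩ := exists_integralFunctional_eq hΛ.1
    have h1 : ∑ q ∈ Q, integralFunctional μ q = 1 := hΛ.2
    have h2 := H μ hlf hμ
    rw [h1, mul_one] at h2
    have h3 : (μ q.1).real (tsupport q.2) ≤ c := ENNReal.toReal_le_of_le_ofReal hc h2
    rw [mem_Icc, ← abs_le, ← Real.norm_eq_abs, integralFunctional,
      ← setIntegral_eq_integral_of_forall_compl_eq_zero (s := tsupport q.2)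
        fun x hx => image_eq_zero_of_notMem_tsupport hx]
    exact (norm_setIntegral_le_of_norm_le_const (h2.trans_lt ENNReal.ofReal_lt_top)
      fun x _ => (hM x).trans (le_max_left _ _)).trans
        (mul_le_mul_of_nonneg_left h3 (le_max_right _ _))
  choose c hc using hbound
  exact (isCompact_univ_pi fun q => isCompact_Icc).of_isClosed_subset
    (isClosed_normalizedCone Hol Q) fun Λ hΛ q _ => hc q Λ hΛ

end System

/-! ### Extreme invariant functionals are ergodic -/

section Ergodic

variable {ι : Type*} {X : ι → Type*} [∀ i, TopologicalSpace (X i)]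
  {Hol : ∀ i j, Set (OpenPartialHomeomorph (X i) (X j))}

/-- The points of `X i` that the pseudo-group moves into the subset `A` of `X i₀`. -/
def saturation (Hol : ∀ i j, Set (OpenPartialHomeomorph (X i) (X j))) {i₀ : ι} (A : Set (X i₀))
    (i : ι) : Set (X i) :=
  ⋃ h : Hol i i₀, h.1.source ∩ h.1 ⁻¹' A

/-- Invariance of `A ⊆ X i` under the elements of the pseudo-group from `X i` to itself. -/
def IsInvariantSet (Hol : ∀ i j, Set (OpenPartialHomeomorph (X i) (X j))) {i : ι}
    (A : Set (X i)) : Prop :=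
  ∀ h ∈ Hol i i, ∀ x ∈ h.source, h x ∈ A ↔ x ∈ A

lemma mem_saturation {i₀ : ι} {A : Set (X i₀)} {i : ι} {x : X i} :
    x ∈ saturation Hol A i ↔ ∃ h ∈ Hol i i₀, x ∈ h.source ∧ h x ∈ A := by
  simp [saturation, and_left_comm]

lemma IsInvariantSet.mem_saturation_iff (hHol : IsPseudogroup Hol) {i₀ : ι} {A : Set (X i₀)}
    (hA : IsInvariantSet Hol A) {i : ι} {h : OpenPartialHomeomorph (X i) (X i₀)}
    (hh : h ∈ Hol i i₀) {x : X i} (hx : x ∈ h.source) : x ∈ saturation Hol A i ↔ h x ∈ A := by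
  refine ⟨fun hs => ?_, fun hs => mem_saturation.2 ⟨h, hh, hx, hs⟩⟩
  obtain ⟨h', hh', hx', hA'⟩ := mem_saturation.1 hs
  have hmem : h' x ∈ (h'.symm.trans h).source := by
    simp [h'.map_source hx', h'.left_inv hx', hx]
  have := hA _ (hHol.trans _ (hHol.symm _ hh') _ hh) _ hmem
  simp only [OpenPartialHomeomorph.coe_trans, Function.comp_apply, h'.left_inv hx'] at this
  exact this.2 hA'

/-- The saturation is invariant under the whole pseudo-group. -/
lemma saturation_invariant (hHol : IsPseudogroup Hol) {i₀ : ι} (A : Set (X i₀)) {i j : ι}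
    {h : OpenPartialHomeomorph (X i) (X j)} (hh : h ∈ Hol i j) {x : X i} (hx : x ∈ h.source) :
    x ∈ saturation Hol A i ↔ h x ∈ saturation Hol A j := by
  simp only [mem_saturation]
  constructor
  · rintro ⟨h', hh', hx', hA⟩
    refine ⟨h.symm.trans h', hHol.trans _ (hHol.symm _ hh) _ hh', ?_, ?_⟩
    · simp [h.map_source hx, h.left_inv hx, hx']
    · simpa [h.left_inv hx] using hA
  · rintro ⟨h', hh', hx', hA⟩
    refine ⟨h.trans h', hHol.trans _ hh _ hh', ?_, ?_⟩
    · simp [hx, hx']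
    · simpa using hA

variable [∀ i, MeasurableSpace (X i)] [∀ i, BorelSpace (X i)]

/-- Although the saturation is an uncountable union of Borel sets, it is Borel: for an invariant
set `A`, it is given on the source of each single `h` by `h ⁻¹' A`, and countably many of these
sources cover. -/
lemma IsInvariantSet.measurableSet_saturation [∀ i, SecondCountableTopology (X i)]
    (hHol : IsPseudogroup Hol) {i₀ : ι} {A : Set (X i₀)} (hA : IsInvariantSet Hol A)
    (hAm : MeasurableSet A) (i : ι) : MeasurableSet (saturation Hol A i) := by
  obtain ⟨C, hC, hCU⟩ := TopologicalSpace.isOpen_iUnion_countable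
    (fun h : Hol i i₀ => h.1.source) fun h => h.1.open_source
  have heq : saturation Hol A i = ⋃ h ∈ C, h.1.source ∩ h.1 ⁻¹' A := by
    apply Subset.antisymm
    · intro x hx
      obtain ⟨h, hh, hx', -⟩ := mem_saturation.1 hx
      have : x ∈ ⋃ h ∈ C, h.1.source := by
        rw [hCU]
        exact mem_iUnion.2 ⟨⟨h, hh⟩, hx'⟩
      obtain ⟨h', hC', hx''⟩ := mem_iUnion₂.1 this
      exact mem_iUnion₂.2 ⟨h', hC', hx'', (hA.mem_saturation_iff hHol h'.2 hx'').1 hx⟩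
    · exact iUnion₂_subset fun h _ => subset_iUnion_of_subset h Subset.rfl
  rw [heq]
  refine MeasurableSet.biUnion hC fun h _ => ?_
  rw [← Subtype.image_preimage_coe]
  exact h.1.open_source.measurableSet.subtype_image
    ((continuousOn_iff_continuous_domRestrict.1 h.1.continuousOn).measurable hAm)

/-- Restricting an invariant family of measures to an invariant family of Borel sets gives an
invariant family. -/
lemma IsInvariant.restrict {μ : ∀ i, Measure (X i)} (hμ : IsInvariant Hol μ)
    {B : ∀ i, Set (X i)} (hB : ∀ i, MeasurableSet (B i))
    (hinv : ∀ i j, ∀ h ∈ Hol i j, ∀ x ∈ h.source, x ∈ B i ↔ h x ∈ B j) :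
    IsInvariant Hol fun i => (μ i).restrict (B i) := by
  intro i j h hh
  ext C hC
  rw [map_restrict_source_apply h _ hC, Measure.restrict_apply' (hB i),
    Measure.restrict_apply' h.open_target.measurableSet, Measure.restrict_apply' (hB j)]
  have h1 := hμ.measure_eq hh (hC.inter (hB j))
  have h2 : h.source ∩ h ⁻¹' C ∩ B i = h.source ∩ h ⁻¹' (C ∩ B j) := by
    ext x
    constructor
    · rintro ⟨⟨hx, hxC⟩, hxB⟩
      exact ⟨hx, hxC, (hinv i j h hh x hx).1 hxB⟩
    · rintro ⟨hx, hxC, hxB⟩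
      exact ⟨⟨hx, hxC⟩, (hinv i j h hh x hx).2 hxB⟩
  rw [h2, h1, inter_right_comm]

variable [∀ i, T2Space (X i)] [∀ i, LocallyCompactSpace (X i)]
  [∀ i, SecondCountableTopology (X i)] {Q : Finset (Test X)}

/-- If an extreme point of the normalized cone charged both an invariant set and its complement,
then cutting the measures along the saturation of this set would exhibit the extreme point as a
convex combination of two different members of the cone. -/
lemma ergodic_of_mem_extremePoints (hHol : IsPseudogroup Hol) (hQ : IsGenerating Hol Q)
    {μ : ∀ i, Measure (X i)} [∀ i, IsLocallyFiniteMeasure (μ i)] (hμ : IsInvariant Hol μ)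
    (hext : integralFunctional μ ∈ extremePoints ℝ (normalizedCone Hol Q)) {i₀ : ι}
    {A : Set (X i₀)} (hAm : MeasurableSet A) (hA : IsInvariantSet Hol A) :
    μ i₀ A = 0 ∨ μ i₀ A = μ i₀ univ := by
  by_contra! hne
  obtain ⟨hne1, hne2⟩ := hne
  set B := saturation Hol A with hB
  have hBm : ∀ i, MeasurableSet (B i) := hA.measurableSet_saturation hHol hAm
  have hBA : B i₀ = A := by
    ext x
    exact hA.mem_saturation_iff hHol (hHol.refl i₀) (mem_univ x)
  have hBc : μ i₀ Aᶜ ≠ 0 := fun h0 => hne2 (measure_eq_measure_of_null_sdiff (subset_univ _)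
    (by rwa [← compl_eq_univ_sdiff]))
  have hμ1 : IsInvariant Hol fun i => (μ i).restrict (B i) :=
    hμ.restrict hBm fun i j h hh x hx => saturation_invariant hHol A hh hx
  have hμ2 : IsInvariant Hol fun i => (μ i).restrict (B i)ᶜ :=
    hμ.restrict (fun i => (hBm i).compl) fun i j h hh x hx =>
      not_congr (saturation_invariant hHol A hh hx)
  set Λ₁ := integralFunctional fun i => (μ i).restrict (B i) with hΛ₁
  set Λ₂ := integralFunctional fun i => (μ i).restrict (B i)ᶜ with hΛ₂
  have hsum : integralFunctional μ = Λ₁ + Λ₂ := by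
    funext q
    exact (integral_add_compl (hBm q.1) q.2.integrable).symm
  set a := ∑ q ∈ Q, Λ₁ q with ha
  set b := ∑ q ∈ Q, Λ₂ q with hb
  have ha0 : 0 < a := hQ.sum_pos hμ1 (i := i₀) (by
    rw [Ne, Measure.restrict_eq_zero, hBA]
    exact hne1)
  have hb0 : 0 < b := hQ.sum_pos hμ2 (i := i₀) (by
    rw [Ne, Measure.restrict_eq_zero, hBA]
    exact hBc)
  have hab : a + b = 1 := by
    rw [ha, hb, ← Finset.sum_add_distrib, ← hext.1.2]
    exact Finset.sum_congr rfl fun q _ => by rw [hsum, Pi.add_apply]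
  have hseg : integralFunctional μ ∈ openSegment ℝ (a⁻¹ • Λ₁) (b⁻¹ • Λ₂) := by
    refine ⟨a, b, ha0, hb0, hab, ?_⟩
    rw [smul_inv_smul₀ ha0.ne', smul_inv_smul₀ hb0.ne', hsum]
  have hΛ : a⁻¹ • Λ₁ = integralFunctional μ :=
    hext.2 (inv_smul_mem_normalizedCone hμ1 ha0) (inv_smul_mem_normalizedCone hμ2 hb0) hseg
  -- the restriction to `A` is a multiple of the whole measure, so it cannot miss `Aᶜ`
  have hmeas : (μ i₀).restrict (B i₀) = ENNReal.ofReal a • μ i₀ := by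
    have : (ENNReal.ofReal a • μ i₀).Regular := Measure.Regular.smul ENNReal.ofReal_ne_top
    refine Measure.ext_of_integral_eq_on_compactlySupported fun f => ?_
    rw [integral_smul_measure, ENNReal.toReal_ofReal ha0.le]
    have h1 : a⁻¹ * Λ₁ ⟨i₀, f⟩ = ∫ x, f x ∂μ i₀ := congrFun hΛ ⟨i₀, f⟩
    rw [smul_eq_mul, ← h1, mul_inv_cancel_left₀ ha0.ne']
    rfl
  have h0 : ENNReal.ofReal a * μ i₀ Aᶜ = 0 := by
    rw [← smul_eq_mul, ← Measure.smul_apply, ← hmeas, hBA,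
      Measure.restrict_apply hAm.compl, compl_inter_self, measure_empty]
  rcases mul_eq_zero.1 h0 with h0 | h0
  · exact ha0.not_ge (ENNReal.ofReal_eq_zero.1 h0)
  · exact hBc h0

/-- A compactly generated pseudo-group that has a non-zero invariant family of locally finite
measures has an ergodic one: the normalized cone is compact, so the Krein–Milman theorem yields an
extreme point. -/
theorem exists_ergodic_of_isGenerating (hHol : IsPseudogroup Hol) (hQ : IsGenerating Hol Q)
    {ν : ∀ i, Measure (X i)} [∀ i, IsLocallyFiniteMeasure (ν i)] (hν : IsInvariant Hol ν)
    {i₁ : ι} (hν0 : ν i₁ ≠ 0) :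
    ∃ μ : ∀ i, Measure (X i), (∀ i, IsLocallyFiniteMeasure (μ i)) ∧ IsInvariant Hol μ ∧
      (∃ i, μ i ≠ 0) ∧ ∀ i (A : Set (X i)), MeasurableSet A → IsInvariantSet Hol A →
        μ i A = 0 ∨ μ i A = μ i univ := by
  obtain ⟨Λ, hΛ⟩ := hQ.isCompact_normalizedCone.extremePoints_nonempty
    ⟨_, inv_smul_mem_normalizedCone hν (hQ.sum_pos hν hν0)⟩
  obtain ⟨μ, hlf, hμ, rfl⟩ := exists_integralFunctional_eq hΛ.1.1
  refine ⟨μ, hlf, hμ, ?_, fun i A hAm hA => ergodic_of_mem_extremePoints hHol hQ hμ hΛ hAm hA⟩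
  by_contra! h0
  have h1 : ∑ q ∈ Q, integralFunctional μ q = 1 := hΛ.1.2
  simp [integralFunctional, h0] at h1

end Ergodic

/-! ### The holonomy pseudo-group -/

section Holonomy

variable {k l : ℕ} {W : Type*} [TopologicalSpace W] [ChartedSpace (Model k l) W]

lemma isLeafPath_const (p : W) : IsLeafPath k l fun _ : I => p :=
  ⟨continuous_const, fun _ _ _ _ => Eventually.of_forall fun _ => rfl⟩

lemma IsLeafPath.comp_symm {γ : I → W} (hγ : IsLeafPath k l γ) :
    IsLeafPath k l fun t => γ (unitInterval.symm t) :=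
  ⟨hγ.1.comp unitInterval.continuous_symm, fun e he t ht =>
    (unitInterval.continuous_symm.tendsto t).eventually (hγ.2 e he _ ht)⟩

lemma IsLeafPath.trans {a b c : W} {γ : Path a b} {γ' : Path b c} (hγ : IsLeafPath k l γ)
    (hγ' : IsLeafPath k l γ') : IsLeafPath k l (γ.trans γ') := by
  refine ⟨(γ.trans γ').continuous, fun e he t ht => ?_⟩
  -- the two reparametrizations of the concatenation, extended to all of `I` by constants
  let u : I → I := fun t => projIcc 0 1 zero_le_one (2 * (t : ℝ))
  let v : I → I := fun t => projIcc 0 1 zero_le_one (2 * (t : ℝ) - 1)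
  have hu : Continuous u := continuous_projIcc.comp (by fun_prop)
  have hv : Continuous v := continuous_projIcc.comp (by fun_prop)
  have h1 : ∀ t : I, (t : ℝ) ≤ 1 / 2 → (γ.trans γ') t = γ (u t) := by
    intro t ht
    rw [Path.trans_apply, dif_pos ht]
    congr 1
    exact (projIcc_of_mem zero_le_one _).symm
  have h2 : ∀ t : I, 1 / 2 ≤ (t : ℝ) → (γ.trans γ') t = γ' (v t) := by
    intro t ht
    rcases ht.eq_or_lt with ht | ht
    · have hut : u t = 1 := by
        simp only [u, ← ht]
        norm_num
      have hvt : v t = 0 := by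
        simp only [v, ← ht]
        norm_num
      rw [h1 t ht.ge, hut, hvt, γ.target, γ'.source]
    · rw [Path.trans_apply, dif_neg (not_le.2 ht)]
      congr 1
      exact (projIcc_of_mem zero_le_one _).symm
  have hcoe : Continuous fun t : I => (t : ℝ) := continuous_subtype_val
  have e1 : (t : ℝ) ≤ 1 / 2 →
      ∀ᶠ t' in 𝓝 t, (e (γ (u t'))).2 = (e ((γ.trans γ') t)).2 := by
    intro h
    rw [h1 t h] at ht ⊢
    exact (hu.tendsto t).eventually (hγ.2 e he _ ht)
  have e2 : 1 / 2 ≤ (t : ℝ) →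
      ∀ᶠ t' in 𝓝 t, (e (γ' (v t'))).2 = (e ((γ.trans γ') t)).2 := by
    intro h
    rw [h2 t h] at ht ⊢
    exact (hv.tendsto t).eventually (hγ'.2 e he _ ht)
  rcases lt_trichotomy (t : ℝ) (1 / 2) with h | h | h
  · filter_upwards [e1 h.le, hcoe.continuousAt.eventually_lt continuousAt_const h] with t' h' h''
    rw [h1 t' h''.le, h']
  · filter_upwards [e1 h.le, e2 h.ge] with t' h' h''
    rcases le_total (t' : ℝ) (1 / 2) with h3 | h3
    · rw [h1 t' h3, h']
    · rw [h2 t' h3, h'']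
  · filter_upwards [e2 h.le, continuousAt_const.eventually_lt hcoe.continuousAt h] with t' h' h''
    rw [h2 t' h''.le, h']

/-- In the definition of holonomy maps the path along which the germ is taken can be recovered
from its lifts. -/
lemma isHolonomyMap_iff {T₁ T₂ : Set W} {h : OpenPartialHomeomorph T₁ T₂} :
    IsHolonomyMap k l h ↔ ∀ p ∈ h.source, ∃ N ∈ 𝓝 p, ∃ H : T₁ → I → W,
      ContinuousOn (Function.uncurry H) (N ×ˢ (univ : Set I)) ∧
      ∀ q ∈ N, IsLeafPath k l (H q) ∧ H q 0 = (q : W) ∧ H q 1 = (h q : W) := by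
  constructor
  · intro hh p hp
    obtain ⟨γ, -, -, -, N, hN, H, hc, -, hH⟩ := hh p hp
    exact ⟨N, hN, H, hc, hH⟩
  · intro hh p hp
    obtain ⟨N, hN, H, hc, hH⟩ := hh p hp
    obtain ⟨h1, h2, h3⟩ := hH p (mem_of_mem_nhds hN)
    exact ⟨H p, h1, h2, h3, N, hN, H, hc, rfl, hH⟩

lemma isHolonomyMap_refl (T : Set W) :
    IsHolonomyMap k l (OpenPartialHomeomorph.refl T) := by
  refine isHolonomyMap_iff.2 fun p _ => ⟨univ, univ_mem, fun q _ => q, ?_, ?_⟩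
  · exact (continuous_subtype_val.comp continuous_fst).continuousOn
  · exact fun q _ => ⟨isLeafPath_const _, rfl, rfl⟩

lemma IsHolonomyMap.symm {T₁ T₂ : Set W} {h : OpenPartialHomeomorph T₁ T₂}
    (hh : IsHolonomyMap k l h) : IsHolonomyMap k l h.symm := by
  refine isHolonomyMap_iff.2 fun p hp => ?_
  obtain ⟨N, hN, H, hc, hH⟩ := isHolonomyMap_iff.1 hh _ (h.map_target hp)
  refine ⟨h.target ∩ h.symm ⁻¹' N, inter_mem (h.open_target.mem_nhds hp)
    ((h.continuousAt_symm hp).preimage_mem_nhds hN),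
    fun q t => H (h.symm q) (unitInterval.symm t), ?_, ?_⟩
  · refine hc.comp (f := fun z : T₂ × I => (h.symm z.1, unitInterval.symm z.2)) ?_ ?_
    · exact ContinuousOn.prodMk (h.continuousOn_symm.comp continuousOn_fst fun z hz => hz.1.1)
        (unitInterval.continuous_symm.comp continuous_snd).continuousOn
    · exact fun z hz => ⟨hz.1.2, mem_univ _⟩
  · rintro q ⟨hq, hqN⟩
    obtain ⟨h1, h2, h3⟩ := hH _ hqN
    refine ⟨h1.comp_symm, ?_, ?_⟩
    · beta_reduce
      rw [unitInterval.symm_zero, h3, h.right_inv hq]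
    · beta_reduce
      rw [unitInterval.symm_one, h2]

lemma IsHolonomyMap.trans {T₁ T₂ T₃ : Set W} {h : OpenPartialHomeomorph T₁ T₂}
    {h' : OpenPartialHomeomorph T₂ T₃} (hh : IsHolonomyMap k l h) (hh' : IsHolonomyMap k l h') :
    IsHolonomyMap k l (h.trans h') := by
  classical
  refine isHolonomyMap_iff.2 fun p hp => ?_
  have hp1 : p ∈ h.source ∧ h p ∈ h'.source := by simpa using hp
  obtain ⟨N, hN, H, hc, hH⟩ := isHolonomyMap_iff.1 hh _ hp1.1
  obtain ⟨N', hN', H', hc', hH'⟩ := isHolonomyMap_iff.1 hh' _ hp1.2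
  set M : Set T₁ := N ∩ (h.source ∩ h ⁻¹' N') with hM
  let P : ∀ q : M, Path (q.1 : W) (h q.1 : W) := fun q =>
    ⟨⟨H q.1, (hH _ q.2.1).1.1⟩, (hH _ q.2.1).2.1, (hH _ q.2.1).2.2⟩
  let P' : ∀ q : M, Path (h q.1 : W) (h' (h q.1) : W) := fun q =>
    ⟨⟨H' (h q.1), (hH' _ q.2.2.2).1.1⟩, (hH' _ q.2.2.2).2.1, (hH' _ q.2.2.2).2.2⟩
  have hP : Continuous ↿P := by
    refine hc.comp_continuous (f := fun z : M × I => (z.1.1, z.2)) (by fun_prop) ?_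
    exact fun z => ⟨z.1.2.1, mem_univ _⟩
  have hP' : Continuous ↿P' := by
    have hcont : Continuous fun q : M => h q.1 :=
      h.continuousOn.comp_continuous continuous_subtype_val fun q => q.2.2.1
    refine hc'.comp_continuous (f := fun z : M × I => (h z.1.1, z.2))
      ((hcont.comp continuous_fst).prodMk continuous_snd) ?_
    exact fun z => ⟨z.1.2.2.2, mem_univ _⟩
  have hPP := Path.trans_continuous_family P hP P' hP'
  refine ⟨M, inter_mem hN (inter_mem (h.open_source.mem_nhds hp1.1)
    ((h.continuousAt hp1.1).preimage_mem_nhds hN')),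
    fun q t => if hq : q ∈ M then (P ⟨q, hq⟩).trans (P' ⟨q, hq⟩) t else q, ?_, ?_⟩
  · rw [continuousOn_iff_continuous_domRestrict]
    have hφ : Continuous fun z : ↥(M ×ˢ (univ : Set I)) => ((⟨z.1.1, z.2.1⟩, z.1.2) : M × I) := by
      fun_prop
    refine (hPP.comp hφ).congr fun z => ?_
    have hz : z.1.1 ∈ M := z.2.1
    simp only [domRestrict_apply, Function.uncurry, dif_pos hz]
    rfl
  · intro q hq
    have hPq : IsLeafPath k l (P ⟨q, hq⟩) := (hH _ hq.1).1
    have hPq' : IsLeafPath k l (P' ⟨q, hq⟩) := (hH' _ hq.2.2).1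
    simp only [dif_pos hq]
    refine ⟨hPq.trans hPq', Path.source _, ?_⟩
    rw [Path.target]
    rfl

variable {r s : WithTop ℕ∞}

/-- The holonomy maps between the local transversals of `S` form a pseudo-group. -/
lemma isPseudogroup_holonomy (S : Set W) :
    IsPseudogroup (X := fun T : LocalTransversal k l r s S => T.1)
      fun _ _ => {h | IsHolonomyMap k l h} where
  refl T := isHolonomyMap_refl T.1
  symm _ hh := IsHolonomyMap.symm hh
  trans _ hh _ hh' := IsHolonomyMap.trans hh hh'

end Holonomy

/-! ### Affine changes of the leaf coordinate -/

section Affine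

variable {k l : ℕ} {r s : WithTop ℕ∞}

lemma IsOfClass.mono {F : Type*} [NormedAddCommGroup F] [NormedSpace ℝ F] {f : Model k l → F}
    {O O' : Set (Model k l)} (hf : IsOfClass r s f O) (h : O' ⊆ O) : IsOfClass r s f O' :=
  ⟨fun y => (hf.1 y).mono fun _ hx => h hx, fun i hi => (hf.2 i hi).mono h⟩

lemma IsOfClass.const_smul_add_const {F : Type*} [NormedAddCommGroup F] [NormedSpace ℝ F]
    {f : Model k l → F} {O : Set (Model k l)} (hO : IsOpen O) (hf : IsOfClass r s f O) (c : ℝ)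
    (b : F) : IsOfClass r s (fun w => c • f w + b) O := by
  refine ⟨fun y => ((hf.1 y).const_smul c).add contDiffOn_const, fun i hi => ?_⟩
  have hconst : ContDiffOn ℝ s (fun z : Model k l => iteratedFDeriv ℝ i (fun _ : E k => b) z.1)
      O := by
    rcases eq_or_ne i 0 with rfl | hi0
    · refine (contDiffOn_const (c := iteratedFDeriv ℝ 0 (fun _ : E k => b) 0)).congr fun z _ => ?_
      ext
      simp
    · rw [iteratedFDeriv_const_of_ne hi0]
      exact contDiffOn_const
  refine (((hf.2 i hi).const_smul c).add hconst).congr fun z hz => ?_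
  have hslice : {x | (x, z.2) ∈ O} ∈ 𝓝 z.1 :=
    (hO.preimage (Continuous.prodMk_left z.2)).mem_nhds hz
  have hfz : ContDiffAt ℝ i (fun x => f (x, z.2)) z.1 :=
    ((hf.1 z.2).contDiffAt hslice).of_le (le_self_add.trans hi)
  rw [← iteratedFDeriv_const_smul_apply hfz]
  exact iteratedFDeriv_add_apply (hfz.const_smul c) contDiffAt_const

/-- No differentiability of `f` is needed, since `x ↦ c x + b` is invertible. -/
lemma iteratedFDeriv_comp_smul_add {F : Type*} [NormedAddCommGroup F] [NormedSpace ℝ F]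
    (f : E k → F) {c : ℝ} (hc : c ≠ 0) (b : E k) (i : ℕ) (x : E k) :
    iteratedFDeriv ℝ i (fun x => f (c • x + b)) x =
      (iteratedFDeriv ℝ i f (c • x + b)).compContinuousLinearMap
        fun _ => (ContinuousLinearEquiv.smulLeft (R₁ := ℝ) (M₁ := E k) (Units.mk0 c hc) :
          E k →L[ℝ] E k) := by
  have h := ContinuousLinearEquiv.iteratedFDerivWithin_comp_right
    (ContinuousLinearEquiv.smulLeft (R₁ := ℝ) (M₁ := E k) (Units.mk0 c hc))
    (fun x => f (x + b)) uniqueDiffOn_univ (mem_univ (_ : E k)) (x := x) i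
  rw [preimage_univ, iteratedFDerivWithin_univ, iteratedFDerivWithin_univ,
    iteratedFDeriv_comp_add_right] at h
  exact h

lemma IsOfClass.comp_leafAffine {F : Type*} [NormedAddCommGroup F] [NormedSpace ℝ F]
    {f : Model k l → F} {O : Set (Model k l)} (hf : IsOfClass r s f O) {c : ℝ} (hc : c ≠ 0)
    (b : E k) :
    IsOfClass r s (fun w => f (c • w.1 + b, w.2)) {w | (c • w.1 + b, w.2) ∈ O} := by
  refine ⟨fun y => ?_, fun i hi => ?_⟩
  · have hA : ContDiff ℝ r fun x : E k => c • x + b :=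
      (contDiff_id.const_smul c).add contDiff_const
    exact (hf.1 y).comp hA.contDiffOn fun x hx => hx
  · have hA : ContDiff ℝ s fun w : Model k l => (c • w.1 + b, w.2) :=
      ((contDiff_fst.const_smul c).add contDiff_const).prodMk contDiff_snd
    have h1 := (hf.2 i hi).comp (t := O) (s := {w : Model k l | (c • w.1 + b, w.2) ∈ O})
      hA.contDiffOn fun x hx => hx
    refine ((ContinuousMultilinearMap.compContinuousLinearMapL (𝕜 := ℝ) (F := F)
      fun _ : Fin i => (ContinuousLinearEquiv.smulLeft (R₁ := ℝ) (M₁ := E k) (Units.mk0 c hc) :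
          E k →L[ℝ] E k)).contDiff.comp_contDiffOn h1).congr fun z _ => ?_
    exact iteratedFDeriv_comp_smul_add (fun x => f (x, z.2)) hc b i z.1

/-- With `c = 1` and `b = 0` this says that restrictions of foliated transitions are foliated
transitions. -/
lemma IsFoliatedTransition.leafAffine_comp {g f : OpenPartialHomeomorph (Model k l) (Model k l)}
    (hg : IsFoliatedTransition r s g) (hsub : f.source ⊆ g.source) (c : ℝ) (b : E k)
    (hfg : ∀ w ∈ f.source, f w = (c • (g w).1 + b, (g w).2)) : IsFoliatedTransition r s f := by
  intro z hz
  obtain ⟨O, hO, hzO, -, X, Y, hX, hY, hXY⟩ := hg z (hsub hz)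
  refine ⟨O ∩ f.source, hO.inter f.open_source, ⟨hzO, hz⟩, inter_subset_right,
    fun w => c • X w + b, Y, (hX.const_smul_add_const hO c b).mono inter_subset_left,
    hY.mono (image_mono inter_subset_left), fun w hw => ?_⟩
  rw [hfg w hw.2, hXY w hw.1]

lemma IsFoliatedTransition.comp_leafAffine {g f : OpenPartialHomeomorph (Model k l) (Model k l)}
    (hg : IsFoliatedTransition r s g) {c : ℝ} (hc : c ≠ 0) (b : E k)
    (hsub : ∀ w ∈ f.source, (c • w.1 + b, w.2) ∈ g.source)
    (hfg : ∀ w ∈ f.source, f w = g (c • w.1 + b, w.2)) : IsFoliatedTransition r s f := by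
  intro z hz
  obtain ⟨O, hO, hzO, -, X, Y, hX, hY, hXY⟩ := hg _ (hsub z hz)
  have hcont : Continuous fun w : Model k l => (c • w.1 + b, w.2) := by fun_prop
  refine ⟨{w | (c • w.1 + b, w.2) ∈ O} ∩ f.source, (hO.preimage hcont).inter f.open_source,
    ⟨hzO, hz⟩, inter_subset_right, fun w => X (c • w.1 + b, w.2), Y,
    (hX.comp_leafAffine hc b).mono inter_subset_left, hY.mono ?_, fun w hw => ?_⟩
  · rintro _ ⟨w, hw, rfl⟩
    exact ⟨_, hw.1, rfl⟩
  · rw [hfg w hw.2, hXY _ hw.1]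

/-- The homeomorphism `(x, y) ↦ (c x + b, y)` of the model space. -/
def leafAffine (l : ℕ) {c : ℝ} (hc : c ≠ 0) (b : E k) : Model k l ≃ₜ Model k l where
  toFun w := (c • w.1 + b, w.2)
  invFun w := (c⁻¹ • w.1 + -(c⁻¹ • b), w.2)
  left_inv w := by simp [smul_smul, hc]
  right_inv w := by simp [smul_smul, hc]
  continuous_toFun := by fun_prop
  continuous_invFun := by fun_prop

variable {W : Type*} [TopologicalSpace W] [ChartedSpace (Model k l) W]

/-- A restriction of a chart of the atlas, followed by an affine change of the leaf coordinate,
is a flow-box. -/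
lemma isFlowBox_of_eq_leafAffine [IsFoliatedManifold k l r s W]
    {e φ : OpenPartialHomeomorph W (Model k l)} (he : e ∈ atlas (Model k l) W)
    (hsub : φ.source ⊆ e.source) {c : ℝ} (hc : c ≠ 0) (b : E k)
    (hφ : ∀ w ∈ φ.source, φ w = leafAffine l hc b (e w)) : IsFlowBox k l r s φ := by
  intro e' he'
  constructor
  · refine (IsFoliatedManifold.transition e' he' e he).leafAffine_comp ?_ c b ?_
    · exact fun z hz => ⟨hz.1, hsub hz.2⟩
    · exact fun z hz => hφ _ hz.2
  · have key : ∀ z ∈ φ.target,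
        (leafAffine l hc b).symm z ∈ e.target ∧
          e.symm ((leafAffine l hc b).symm z) = φ.symm z := by
      intro z hz
      have h1 := hφ _ (φ.map_target hz)
      rw [φ.right_inv hz] at h1
      have h2 : (leafAffine l hc b).symm z = e (φ.symm z) := by
        conv_lhs => rw [h1]
        exact (leafAffine l hc b).symm_apply_apply _
      rw [h2]
      exact ⟨e.map_source (hsub (φ.map_target hz)), e.left_inv (hsub (φ.map_target hz))⟩
    refine (IsFoliatedManifold.transition (r := r) (s := s) e he e' he').comp_leafAffine
      (inv_ne_zero hc) (-(c⁻¹ • b)) ?_ ?_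
    · intro z hz
      obtain ⟨h1, h2⟩ := key z hz.1
      refine ⟨h1, ?_⟩
      change e.symm ((leafAffine l hc b).symm z) ∈ e'.source
      rw [h2]
      exact hz.2
    · intro z hz
      obtain ⟨h1, h2⟩ := key z hz.1
      change e' (φ.symm z) = e' (e.symm ((leafAffine l hc b).symm z))
      rw [h2]

end Affine

/-! ### Plaques and flow-boxes -/

section Plaques

variable {k l : ℕ} {r s : WithTop ℕ∞} {W : Type*} [TopologicalSpace W]

lemma IsFoliatedTransition.eventually_snd_eq {φ ψ : OpenPartialHomeomorph W (Model k l)}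
    (h : IsFoliatedTransition r s (φ.symm.trans ψ)) {q : W} (hφ : q ∈ φ.source)
    (hψ : q ∈ ψ.source) :
    ∃ N ∈ 𝓝 q, ∀ a ∈ N, ∀ a' ∈ N, (φ a).2 = (φ a').2 → (ψ a).2 = (ψ a').2 := by
  have hq : φ q ∈ (φ.symm.trans ψ).source := by
    simp [φ.map_source hφ, φ.left_inv hφ, hψ]
  obtain ⟨O, hO, hqO, -, X, Y, -, -, hXY⟩ := h _ hq
  refine ⟨φ.source ∩ φ ⁻¹' O, (φ.isOpen_inter_preimage hO).mem_nhds ⟨hφ, hqO⟩, ?_⟩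
  rintro a ⟨ha, haO⟩ a' ⟨ha', haO'⟩ haa'
  have h1 := congrArg Prod.snd (hXY _ haO)
  have h2 := congrArg Prod.snd (hXY _ haO')
  simp only [OpenPartialHomeomorph.coe_trans, Function.comp_apply, φ.left_inv ha,
    φ.left_inv ha'] at h1 h2
  rw [h1, h2, haa']

variable [ChartedSpace (Model k l) W]

/-- Near a common point of two flow-boxes, points on a common plaque of the first one lie on a
common plaque of the second one. -/
lemma IsFlowBox.eventually_snd_eq {φ ψ : OpenPartialHomeomorph W (Model k l)}
    (hφ : IsFlowBox k l r s φ) (hψ : IsFlowBox k l r s ψ) {q : W} (hqφ : q ∈ φ.source)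
    (hqψ : q ∈ ψ.source) :
    ∃ N ∈ 𝓝 q, ∀ a ∈ N, ∀ a' ∈ N, (φ a).2 = (φ a').2 → (ψ a).2 = (ψ a').2 := by
  set e := chartAt (Model k l) q with he
  have hea : e ∈ atlas (Model k l) W := chart_mem_atlas _ q
  have hqe : q ∈ e.source := mem_chart_source _ q
  obtain ⟨N, hN, h1⟩ := (hφ e hea).2.eventually_snd_eq hqφ hqe
  obtain ⟨N', hN', h2⟩ := (hψ e hea).1.eventually_snd_eq hqe hqψ
  exact ⟨N ∩ N', inter_mem hN hN', fun a ha a' ha' haa' =>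
    h2 a ha.2 a' ha'.2 (h1 a ha.1 a' ha'.1 haa')⟩

/-- A path in a plaque of a flow-box is contained in a leaf. -/
lemma IsFlowBox.isLeafPath {φ : OpenPartialHomeomorph W (Model k l)} (hφ : IsFlowBox k l r s φ)
    {c : I → E k} (hc : Continuous c) {y : E l} (hcy : ∀ t, (c t, y) ∈ φ.target) :
    IsLeafPath k l fun t => φ.symm (c t, y) := by
  have hcont : Continuous fun t => φ.symm (c t, y) :=
    φ.continuousOn_symm.comp_continuous (hc.prodMk continuous_const) hcy
  refine ⟨hcont, fun e he t ht => ?_⟩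
  obtain ⟨N, hN, h⟩ := (hφ e he).2.eventually_snd_eq (φ.map_target (hcy t)) ht
  filter_upwards [hcont.continuousAt.preimage_mem_nhds hN] with t' ht'
  refine h _ ht' _ (mem_of_mem_nhds hN) ?_
  rw [φ.right_inv (hcy t), φ.right_inv (hcy t')]

/-- The plaques of a flow-box whose image is convex in the leaf direction are contained in `S` as
soon as they meet `S`. -/
lemma IsPreSolenoid.symm_mem {S : Set W} (hS : IsPreSolenoid k l S)
    {φ : OpenPartialHomeomorph W (Model k l)} (hφ : IsFlowBox k l r s φ) {D : Set (E k)}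
    (hD : Convex ℝ D) {x x' : E k} {y : E l} (hDy : ∀ z ∈ D, (z, y) ∈ φ.target) (hx : x ∈ D)
    (hx' : x' ∈ D) (hxS : φ.symm (x, y) ∈ S) : φ.symm (x', y) ∈ S := by
  have hmem : ∀ t : I, AffineMap.lineMap x x' (t : ℝ) ∈ D := fun t =>
    hD.lineMap_mem hx hx' t.2
  refine hS.leaf_subset _ hxS ⟨fun t => φ.symm (AffineMap.lineMap x x' (t : ℝ), y),
    hφ.isLeafPath (c := fun t : I => AffineMap.lineMap x x' (t : ℝ)) ?_ fun t => hDy _ (hmem t),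
    ?_, ?_⟩
  · exact AffineMap.lineMap_continuous.comp continuous_subtype_val
  · simp
  · simp

/-- Every point is the centre of a flow-box of the solenoid: restrict a chart to a small product of
balls and rescale the leaf coordinate. -/
lemma IsPreSolenoid.exists_flowBox [T2Space W] [IsFoliatedManifold k l r s W] {S : Set W}
    (hS : IsPreSolenoid k l S) (p : W) :
    ∃ B : FlowBox k l r s S, p ∈ B.chart.source ∧ (B.chart p).1 = 0 := by
  set e := chartAt (Model k l) p with he
  have hea : e ∈ atlas (Model k l) W := chart_mem_atlas _ p
  have hpe : p ∈ e.source := mem_chart_source _ p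
  obtain ⟨ε, hε, hball⟩ := Metric.nhds_basis_closedBall.mem_iff.1
    (e.open_target.mem_nhds (e.map_source hpe))
  rw [← Prod.mk.eta (p := e p), ← closedBall_prod_same] at hball
  set x₀ := (e p).1
  set y₀ := (e p).2
  set A : Model k l ≃ₜ Model k l :=
    leafAffine l (inv_ne_zero hε.ne') (-(ε⁻¹ • x₀)) with hA
  have hAapp : ∀ w, A w = (ε⁻¹ • (w.1 - x₀), w.2) := fun w => by
    change (ε⁻¹ • w.1 + -(ε⁻¹ • x₀), w.2) = _
    rw [smul_sub, sub_eq_add_neg]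
  set φ := e.transHomeomorph A with hφ
  have hφF : IsFlowBox k l r s φ :=
    isFlowBox_of_eq_leafAffine hea Subset.rfl (inv_ne_zero hε.ne') (-(ε⁻¹ • x₀)) fun w _ => rfl
  have hV' : Metric.closedBall (0 : E k) 1 ×ˢ Metric.closedBall y₀ ε ⊆ φ.target := by
    rintro ⟨x, y⟩ ⟨hx, hy⟩
    have h1 : (x, y) = A (ε • x + x₀, y) := by
      rw [hAapp, add_sub_cancel_right, inv_smul_smul₀ hε.ne']
    change A.symm (x, y) ∈ e.target
    rw [h1, A.symm_apply_apply]
    refine hball ⟨?_, hy⟩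
    rw [mem_closedBall_zero_iff] at hx
    rw [mem_closedBall_iff_norm, add_sub_cancel_right, norm_smul, Real.norm_of_nonneg hε.le]
    exact mul_le_of_le_one_right hε.le hx
  set V : Set (Model k l) := Metric.ball (0 : E k) 1 ×ˢ Metric.ball y₀ ε with hVdef
  have hVV' : V ⊆ Metric.closedBall (0 : E k) 1 ×ˢ Metric.closedBall y₀ ε :=
    prod_mono Metric.ball_subset_closedBall Metric.ball_subset_closedBall
  have hV : V ⊆ φ.target := hVV'.trans hV'
  have hVo : IsOpen V := Metric.isOpen_ball.prod Metric.isOpen_ball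
  have hU : IsOpen (φ.source ∩ φ ⁻¹' V) := φ.isOpen_inter_preimage hVo
  set ψ := φ.restrOpen _ hU with hψ
  have hψs : ψ.source = φ.source ∩ φ ⁻¹' V := by
    rw [hψ, OpenPartialHomeomorph.restrOpen_source, inter_eq_right.2 inter_subset_left]
  have hpA : φ p = (0, y₀) := by
    change A (e p) = _
    rw [hAapp, sub_self, smul_zero]
  refine ⟨{
    chart := ψ
    isFlowBox := isFlowBox_of_eq_leafAffine hea (hψs ▸ inter_subset_left)
      (inv_ne_zero hε.ne') (-(ε⁻¹ • x₀)) fun w _ => rfl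
    -- by saturation under plaques, membership in `S` can be read off at the leaf coordinate `0`
    K := {y | y ∈ Metric.ball y₀ ε ∧ φ.symm (0, y) ∈ S}
    image_eq := ?_
    good := ⟨φ, hφF, ?_, fun w _ => rfl⟩ }, ?_, ?_⟩
  · rw [hψs]
    have hplaque : ∀ y ∈ Metric.ball y₀ ε, ∀ z ∈ Metric.ball (0 : E k) 1, (z, y) ∈ φ.target :=
      fun y hy z hz => hV ⟨hz, hy⟩
    have h0 : (0 : E k) ∈ Metric.ball (0 : E k) 1 := Metric.mem_ball_self one_pos
    apply Subset.antisymm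
    · rintro _ ⟨w, ⟨⟨hw, hwV⟩, hwS⟩, rfl⟩
      refine ⟨hwV.1, hwV.2, ?_⟩
      refine hS.symm_mem hφF (convex_ball 0 1) (hplaque _ hwV.2) hwV.1 h0 ?_
      change φ.symm (φ w) ∈ S
      rw [φ.left_inv hw]
      exact hwS
    · rintro ⟨x, y⟩ ⟨hx, hy, hyS⟩
      have hxy : (x, y) ∈ φ.target := hplaque y hy x hx
      refine ⟨φ.symm (x, y), ⟨⟨φ.map_target hxy, ?_⟩, ?_⟩, φ.right_inv hxy⟩
      · rw [mem_preimage, φ.right_inv hxy]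
        exact ⟨hx, hy⟩
      · exact hS.symm_mem hφF (convex_ball 0 1) (hplaque y hy) h0 hx hyS
  · -- the closure stays in the compact image of a product of closed balls
    have hcomp : IsCompact
        (φ.symm '' (Metric.closedBall (0 : E k) 1 ×ˢ Metric.closedBall y₀ ε)) :=
      ((isCompact_closedBall _ _).prod (isCompact_closedBall _ _)).image_of_continuousOn
        (φ.continuousOn_symm.mono hV')
    refine (closure_minimal ?_ hcomp.isClosed).trans ?_
    · rintro w ⟨hw, -⟩
      rw [hψs] at hw
      exact ⟨φ w, hVV' hw.2, φ.left_inv hw.1⟩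
    · rintro _ ⟨z, hz, rfl⟩
      exact φ.map_target (hV' hz)
  · change p ∈ ψ.source
    rw [hψs]
    refine ⟨hpe, ?_⟩
    rw [mem_preimage, hpA]
    exact ⟨Metric.mem_ball_self one_pos, Metric.mem_ball_self hε⟩
  · change (φ p).1 = 0
    rw [hpA]

end Plaques

section Slide

variable {k l : ℕ} {r s : WithTop ℕ∞} {W : Type*} [TopologicalSpace W]
  [ChartedSpace (Model k l) W] {S : Set W}

namespace FlowBox

variable (B : FlowBox k l r s S)

/-- The open subset `U` of `S` on which the flow-box is defined. -/
def dom : Set W := B.chart.source ∩ S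

/-- The slice `φ⁻¹({0} × K)`. -/
def slice : Set W := {w ∈ B.dom | (B.chart w).1 = 0}

/-- Moves the point `w` within its plaque to the point with leaf coordinate `x`. -/
def slide (x : E k) (w : W) : W := B.chart.symm (x, (B.chart w).2)

variable {B} {x x' : E k} {w : W}

lemma chart_mem (hw : w ∈ B.dom) : B.chart w ∈ Metric.ball (0 : E k) 1 ×ˢ B.K :=
  B.image_eq ▸ mem_image_of_mem _ hw

lemma mem_target {z : Model k l} (hz : z ∈ Metric.ball (0 : E k) 1 ×ˢ B.K) :
    z ∈ B.chart.target ∧ B.chart.symm z ∈ B.dom := by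
  rw [← B.image_eq] at hz
  obtain ⟨w, hw, rfl⟩ := hz
  refine ⟨B.chart.map_source hw.1, ?_⟩
  rw [B.chart.left_inv hw.1]
  exact hw

lemma pair_mem (hx : x ∈ Metric.ball (0 : E k) 1) (hw : w ∈ B.dom) :
    (x, (B.chart w).2) ∈ Metric.ball (0 : E k) 1 ×ˢ B.K :=
  ⟨hx, (chart_mem hw).2⟩

lemma slide_mem (hx : x ∈ Metric.ball (0 : E k) 1) (hw : w ∈ B.dom) : B.slide x w ∈ B.dom :=
  (mem_target (pair_mem hx hw)).2

lemma chart_slide (hx : x ∈ Metric.ball (0 : E k) 1) (hw : w ∈ B.dom) :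
    B.chart (B.slide x w) = (x, (B.chart w).2) :=
  B.chart.right_inv (mem_target (pair_mem hx hw)).1

lemma slide_eq_self (hw : w ∈ B.dom) (hx : (B.chart w).1 = x) : B.slide x w = w := by
  rw [slide, ← hx, Prod.mk.eta, B.chart.left_inv hw.1]

lemma slide_congr {w' : W} (h : (B.chart w).2 = (B.chart w').2) :
    B.slide x w = B.slide x w' := by
  rw [slide, slide, h]

lemma zero_mem : (0 : E k) ∈ Metric.ball (0 : E k) 1 := Metric.mem_ball_self one_pos

lemma slide_zero_mem_slice (hw : w ∈ B.dom) : B.slide 0 w ∈ B.slice :=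
  ⟨slide_mem zero_mem hw, by rw [chart_slide zero_mem hw]⟩

lemma continuousOn_slide :
    ContinuousOn (fun z : E k × W => B.slide z.1 z.2) (Metric.ball (0 : E k) 1 ×ˢ B.dom) := by
  have h1 : ContinuousOn (fun z : E k × W => (z.1, (B.chart z.2).2))
      (Metric.ball (0 : E k) 1 ×ˢ B.dom) :=
    continuousOn_fst.prodMk (continuous_snd.comp_continuousOn
      (B.chart.continuousOn.comp continuousOn_snd fun z hz => hz.2.1))
  exact B.chart.continuousOn_symm.comp h1 fun z hz => (mem_target (pair_mem hz.1 hz.2)).1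

lemma continuousOn_slide_right (hx : x ∈ Metric.ball (0 : E k) 1) :
    ContinuousOn (B.slide x) B.dom :=
  continuousOn_slide.comp (f := fun w => (x, w))
    (continuous_const.prodMk continuous_id).continuousOn fun _ hw => ⟨hx, hw⟩

/-- The segment, within a plaque, from `w` to the slice. -/
def segment (B : FlowBox k l r s S) (w : W) (t : I) : W :=
  B.slide ((1 - (t : ℝ)) • (B.chart w).1) w

lemma smul_mem_ball (hx : x ∈ Metric.ball (0 : E k) 1) (t : I) :
    (1 - (t : ℝ)) • x ∈ Metric.ball (0 : E k) 1 := by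
  rw [mem_ball_zero_iff] at hx ⊢
  rw [norm_smul, Real.norm_of_nonneg (sub_nonneg.2 t.2.2)]
  exact (mul_le_of_le_one_left (norm_nonneg x) (sub_le_self 1 t.2.1)).trans_lt hx

lemma continuousOn_segment :
    ContinuousOn (Function.uncurry B.segment) (B.dom ×ˢ (univ : Set I)) := by
  refine continuousOn_slide.comp
    (f := fun z : W × I => ((1 - (z.2 : ℝ)) • (B.chart z.1).1, z.1)) ?_ ?_
  · have hc : Continuous fun z : W × I => 1 - (z.2 : ℝ) := by fun_prop
    refine ContinuousOn.prodMk (hc.continuousOn.smul ?_) continuousOn_fst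
    exact continuous_fst.comp_continuousOn
      (B.chart.continuousOn.comp continuousOn_fst fun z hz => hz.1.1)
  · exact fun z hz => ⟨smul_mem_ball (chart_mem hz.1).1 z.2, hz.1⟩

lemma isLeafPath_segment (hw : w ∈ B.dom) : IsLeafPath k l (B.segment w) :=
  B.isFlowBox.isLeafPath (by fun_prop) fun t =>
    (mem_target (pair_mem (smul_mem_ball (chart_mem hw).1 t) hw)).1

lemma segment_zero (hw : w ∈ B.dom) : B.segment w 0 = w :=
  slide_eq_self hw (by simp)

lemma segment_one : B.segment w 1 = B.slide 0 w := by simp [segment]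

end FlowBox

/-- A local transversal is the full slice of any flow-box that exhibits it as such. -/
lemma eq_slice {B : FlowBox k l r s S} {T : Set W} (hT : T ⊆ B.chart.source ∩ S)
    (himg : B.chart '' T = ({0} : Set (E k)) ×ˢ B.K) : T = B.slice := by
  apply Subset.antisymm
  · intro w hw
    have : B.chart w ∈ ({0} : Set (E k)) ×ˢ B.K := himg ▸ mem_image_of_mem _ hw
    exact ⟨hT hw, this.1⟩
  · rintro w ⟨hw, hw0⟩
    have : B.chart w ∈ B.chart '' T := by
      rw [himg]
      exact ⟨hw0, (FlowBox.chart_mem hw).2⟩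
    obtain ⟨w', hw', heq⟩ := this
    rwa [← B.chart.injOn (hT hw').1 hw.1 heq]

lemma FlowBox.isLocalTransversalAt {B : FlowBox k l r s S} {p : W} (hp : p ∈ B.slice) :
    IsLocalTransversalAt k l r s S B.slice p := by
  refine ⟨hp, B, fun _ hw => hw.1, ?_⟩
  apply Subset.antisymm
  · rintro _ ⟨w, hw, rfl⟩
    exact ⟨hw.2, (chart_mem hw.1).2⟩
  · rintro ⟨x, y⟩ ⟨hx, hy⟩
    obtain rfl : x = 0 := hx
    have hz : ((0 : E k), y) ∈ Metric.ball (0 : E k) 1 ×ˢ B.K := ⟨zero_mem, hy⟩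
    refine ⟨B.chart.symm (0, y), ⟨(mem_target hz).2, ?_⟩, B.chart.right_inv (mem_target hz).1⟩
    rw [B.chart.right_inv (mem_target hz).1]

lemma LocalTransversal.exists_eq_slice (T : LocalTransversal k l r s S) :
    ∃ B : FlowBox k l r s S, T.1 = B.slice := by
  obtain ⟨p, -, B, hT, himg⟩ := T.2
  exact ⟨B, eq_slice hT himg⟩

/-- A local transversal is locally closed in `W`, because `S` is closed. -/
lemma LocalTransversal.locallyCompactSpace [T2Space W] (hS : IsPreSolenoid k l S)
    (T : LocalTransversal k l r s S) : LocallyCompactSpace T.1 := by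
  obtain ⟨B, hB⟩ := T.exists_eq_slice
  have : LocallyCompactSpace W := ChartedSpace.locallyCompactSpace (Model k l) W
  have hcont : ContinuousOn (fun w => (B.chart w).1) B.chart.source :=
    continuous_fst.comp_continuousOn B.chart.continuousOn
  obtain ⟨F, hF, hFe⟩ := continuousOn_iff_isClosed.1 hcont {0} isClosed_singleton
  have heq : T.1 = B.chart.source ∩ (F ∩ S) := by
    rw [hB]
    ext w
    constructor
    · rintro ⟨⟨hw, hwS⟩, hw0⟩
      exact ⟨hw, (hFe.le ⟨hw0, hw⟩).1, hwS⟩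
    · rintro ⟨hw, hwF, hwS⟩
      exact ⟨⟨hw, hwS⟩, (hFe.ge ⟨hwF, hw⟩).1⟩
  have hlc : IsLocallyClosed T.1 :=
    ⟨_, _, B.chart.open_source, hF.inter hS.isCompact.isClosed, heq⟩
  exact hlc.locallyCompactSpace

/-- `W` need not be second countable, but a local transversal embeds into the model space. -/
lemma LocalTransversal.secondCountableTopology (T : LocalTransversal k l r s S) :
    SecondCountableTopology T.1 := by
  obtain ⟨B, hB⟩ := T.exists_eq_slice
  have hsub : T.1 ⊆ B.chart.source := by
    rw [hB]
    exact fun w hw => hw.1.1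
  exact (B.chart.isOpenEmbedding_restrict.isEmbedding.comp
    (IsEmbedding.inclusion hsub)).secondCountableTopology

end Slide

/-! ### Compact generation of the holonomy pseudo-group -/

/-- Two maps that are continuous and mutually inverse near a point restrict to a partial
homeomorphism. -/
lemma exists_openPartialHomeomorph_of_eventually {A B : Type*} [TopologicalSpace A]
    [TopologicalSpace B] {f : A → B} {g : B → A} {a₀ : A} {A₀ : Set A} {B₀ : Set B}
    (hA₀ : A₀ ∈ 𝓝 a₀) (hf : ContinuousOn f A₀) (hB₀ : B₀ ∈ 𝓝 (f a₀)) (hg : ContinuousOn g B₀)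
    (hgf : ∀ᶠ a in 𝓝 a₀, g (f a) = a) (hfg : ∀ᶠ b in 𝓝 (f a₀), f (g b) = b) :
    ∃ h : OpenPartialHomeomorph A B, h.source ⊆ A₀ ∧ a₀ ∈ h.source ∧ ∀ a, h a = f a := by
  obtain ⟨A₁, hA₁, hA₁o, hA₁m⟩ := mem_nhds_iff.1 (inter_mem hA₀ hgf)
  obtain ⟨B₁, hB₁, hB₁o, hB₁m⟩ := mem_nhds_iff.1 (inter_mem hB₀ hfg)
  have hgf' : ∀ a ∈ A₁, g (f a) = a := fun a ha => (hA₁ ha).2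
  have hfg' : ∀ b ∈ B₁, f (g b) = b := fun b hb => (hB₁ hb).2
  have hf' : ContinuousOn f A₁ := hf.mono fun a ha => (hA₁ ha).1
  have hg' : ContinuousOn g B₁ := hg.mono fun b hb => (hB₁ hb).1
  refine ⟨{
    toFun := f
    invFun := g
    source := A₁ ∩ f ⁻¹' B₁
    target := B₁ ∩ g ⁻¹' A₁
    map_source' := fun a ha => ⟨ha.2, by rw [mem_preimage, hgf' a ha.1]; exact ha.1⟩
    map_target' := fun b hb => ⟨hb.2, by rw [mem_preimage, hfg' b hb.1]; exact hb.1⟩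
    left_inv' := fun a ha => hgf' a ha.1
    right_inv' := fun b hb => hfg' b hb.1
    continuousOn_toFun := hf'.mono inter_subset_left
    continuousOn_invFun := hg'.mono inter_subset_left
    open_source := hf'.isOpen_inter_preimage hA₁o hB₁o
    open_target := hg'.isOpen_inter_preimage hB₁o hA₁o }, ?_, ?_, fun a => rfl⟩
  · exact fun a ha => (hA₁ ha.1).1
  · exact ⟨hA₁m, hB₁m⟩

section Generation

variable {k l : ℕ} {r s : WithTop ℕ∞} {W : Type*} [TopologicalSpace W]
  [ChartedSpace (Model k l) W] {S : Set W}

open FlowBox in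
/-- From a point `q` of a slice that lies in the domain of a second flow-box `B₂`, sliding along
the plaques of `B₂` is a holonomy map to the slice of `B₂`. Its inverse slides the points of the
second slice along the plaques of `B₂` into the vicinity of `q`, then along those of `B₁`. -/
lemma exists_holonomyMap_slide (B₁ B₂ : FlowBox k l r s S) (q : B₁.slice)
    (hq : (q : W) ∈ B₂.dom) :
    ∃ h : OpenPartialHomeomorph B₁.slice B₂.slice, IsHolonomyMap k l h ∧ q ∈ h.source ∧
      (h q : W) = B₂.slide 0 q := by
  classical
  set x₁ := (B₂.chart q).1 with hx₁
  have hx₁b : x₁ ∈ Metric.ball (0 : E k) 1 := (chart_mem hq).1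
  let b₀ : B₂.slice := ⟨B₂.slide 0 q, slide_zero_mem_slice hq⟩
  let f : B₁.slice → B₂.slice := fun a =>
    if ha : (a : W) ∈ B₂.dom then ⟨B₂.slide 0 a, slide_zero_mem_slice ha⟩ else b₀
  let g : B₂.slice → B₁.slice := fun b =>
    if hb : B₂.slide x₁ b ∈ B₁.dom then ⟨B₁.slide 0 (B₂.slide x₁ b), slide_zero_mem_slice hb⟩
    else q
  have hfv : ∀ a : B₁.slice, (a : W) ∈ B₂.dom → (f a : W) = B₂.slide 0 a := fun a ha => by
    simp only [f, dif_pos ha]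
  have hgv : ∀ b : B₂.slice, B₂.slide x₁ b ∈ B₁.dom →
      (g b : W) = B₁.slide 0 (B₂.slide x₁ b) := fun b hb => by
    simp only [g, dif_pos hb]
  have hfq : f q = b₀ := by simp only [f, dif_pos hq, b₀]
  -- membership in `S` is automatic, so the domains below are open
  have hdom₂ : ∀ {a : B₁.slice}, (a : W) ∈ B₂.chart.source → (a : W) ∈ B₂.dom :=
    fun {a} ha => ⟨ha, a.2.1.2⟩
  have hslide : ∀ b : B₂.slice, B₂.slide x₁ b ∈ B₂.dom := fun b => slide_mem hx₁b b.2.1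
  have hdom₁ : ∀ {b : B₂.slice}, B₂.slide x₁ b ∈ B₁.chart.source → B₂.slide x₁ b ∈ B₁.dom :=
    fun {b} hb => ⟨hb, (hslide b).2⟩
  have hslide_cont : Continuous fun b : B₂.slice => B₂.slide x₁ b :=
    (continuousOn_slide_right hx₁b).comp_continuous continuous_subtype_val fun b => b.2.1
  have hslide_b₀ : B₂.slide x₁ b₀ = q := by
    rw [slide_congr (w' := (q : W)) (by rw [chart_slide zero_mem hq]), slide_eq_self hq rfl]
  have hA₀ : {a : B₁.slice | (a : W) ∈ B₂.chart.source} ∈ 𝓝 q :=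
    (B₂.chart.open_source.preimage continuous_subtype_val).mem_nhds hq.1
  have hB₀ : {b : B₂.slice | B₂.slide x₁ b ∈ B₁.chart.source} ∈ 𝓝 (f q) := by
    refine (B₁.chart.open_source.preimage hslide_cont).mem_nhds ?_
    rw [hfq, mem_preimage, hslide_b₀]
    exact q.2.1.1
  have hf : ContinuousOn f {a : B₁.slice | (a : W) ∈ B₂.chart.source} := by
    rw [IsInducing.subtypeVal.continuousOn_iff]
    exact ((continuousOn_slide_right zero_mem).comp continuous_subtype_val.continuousOn
      fun a ha => hdom₂ ha).congr fun a ha => hfv a (hdom₂ ha)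
  have hg : ContinuousOn g {b : B₂.slice | B₂.slide x₁ b ∈ B₁.chart.source} := by
    rw [IsInducing.subtypeVal.continuousOn_iff]
    exact ((continuousOn_slide_right zero_mem).comp hslide_cont.continuousOn
      fun b hb => hdom₁ hb).congr fun b hb => hgv b (hdom₁ hb)
  -- near `q` the two flow-boxes have the same plaques, which makes `f` and `g` mutually inverse
  obtain ⟨N, hN, hN₁⟩ := B₁.isFlowBox.eventually_snd_eq B₂.isFlowBox q.2.1.1 hq.1
  obtain ⟨N', hN', hN₂⟩ := B₂.isFlowBox.eventually_snd_eq B₁.isFlowBox hq.1 q.2.1.1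
  have hgf : ∀ᶠ a in 𝓝 q, g (f a) = a := by
    have h1 : ∀ᶠ a in 𝓝 q, B₂.slide x₁ (f a) ∈ N' ∩ B₁.chart.source := by
      refine (hslide_cont.continuousAt.comp (hf.continuousAt hA₀)).preimage_mem_nhds ?_
      rw [Function.comp_apply, hfq, hslide_b₀]
      exact inter_mem hN' (B₁.chart.open_source.mem_nhds q.2.1.1)
    filter_upwards [h1, hA₀, continuous_subtype_val.continuousAt.preimage_mem_nhds hN']
      with a ha ha₀ haN
    have ha₂ := hdom₂ ha₀
    apply Subtype.ext
    rw [hgv _ (hdom₁ ha.2), slide_congr (w' := (a : W)) (hN₂ _ ha.1 _ haN ?_),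
      slide_eq_self a.2.1 a.2.2]
    rw [chart_slide hx₁b (f a).2.1, hfv a ha₂, chart_slide zero_mem ha₂]
  have hfg : ∀ᶠ b in 𝓝 (f q), f (g b) = b := by
    have hgq : g (f q) = q := hgf.self_of_nhds
    have h1 : ∀ᶠ b in 𝓝 (f q), ((g b : B₁.slice) : W) ∈ N ∩ B₂.chart.source := by
      refine (continuous_subtype_val.continuousAt.comp
        (hg.continuousAt hB₀)).preimage_mem_nhds ?_
      rw [Function.comp_apply, hgq]
      exact inter_mem hN (B₂.chart.open_source.mem_nhds hq.1)
    have h2 : ∀ᶠ b in 𝓝 (f q), B₂.slide x₁ (b : B₂.slice) ∈ N := by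
      refine hslide_cont.continuousAt.preimage_mem_nhds ?_
      rw [hfq, hslide_b₀]
      exact hN
    filter_upwards [h1, h2, hB₀] with b hb hbN hb₀
    have hb₁ := hdom₁ hb₀
    apply Subtype.ext
    rw [hfv _ (hdom₂ hb.2), slide_congr (w' := B₂.slide x₁ b) (hN₁ _ hb.1 _ hbN ?_),
      slide_congr (w' := (b : W)) (by rw [chart_slide hx₁b b.2.1]), slide_eq_self b.2.1 b.2.2]
    rw [hgv b hb₁, chart_slide zero_mem hb₁]
  obtain ⟨h, hsub, hqs, hh⟩ :=
    exists_openPartialHomeomorph_of_eventually hA₀ hf hB₀ hg hgf hfg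
  refine ⟨h, isHolonomyMap_iff.2 fun p hp => ?_, hqs, by rw [hh, hfv q hq]⟩
  -- the holonomy path and its lifts are the segments along which the points slide
  refine ⟨h.source, h.open_source.mem_nhds hp, fun a => B₂.segment a, ?_, fun a ha => ?_⟩
  · exact continuousOn_segment.comp (f := fun z : B₁.slice × I => ((z.1 : W), z.2))
      (by fun_prop) fun z hz => ⟨hdom₂ (hsub hz.1), mem_univ _⟩
  · have ha₂ := hdom₂ (hsub ha)
    exact ⟨isLeafPath_segment ha₂, segment_zero ha₂, segment_one.trans (by rw [hh, hfv a ha₂])⟩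

/-- Compactness of `S` yields finitely many test functions, on slices of flow-boxes that cover `S`,
which generate the holonomy pseudo-group. -/
lemma IsPreSolenoid.exists_isGenerating [T2Space W] [IsFoliatedManifold k l r s W]
    (hS : IsPreSolenoid k l S) :
    ∃ Q : Finset (Test fun T : LocalTransversal k l r s S => T.1),
      IsGenerating (fun _ _ => {h | IsHolonomyMap k l h}) Q := by
  classical
  -- the property that finitely many test functions serve all points of `A`, for an induction over
  -- the subsets of the compact set `S`
  let P : Set W → Prop := fun A =>
    ∃ Q : Finset (Test fun T : LocalTransversal k l r s S => T.1),
      (∀ q ∈ Q, ∀ x, 0 ≤ q.2 x) ∧ ∀ (T : LocalTransversal k l r s S) (x : T.1), (x : W) ∈ A →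
        ∃ q ∈ Q, ∃ h : OpenPartialHomeomorph T.1 q.1.1, IsHolonomyMap k l h ∧ x ∈ h.source ∧
          0 < q.2 (h x)
  have hind : P S := by
    refine hS.isCompact.induction_on ?_ ?_ ?_ ?_
    · exact ⟨∅, by simp, fun T x hx => hx.elim⟩
    · rintro A A' hAA' ⟨Q, hQ0, hQ⟩
      exact ⟨Q, hQ0, fun T x hx => hQ T x (hAA' hx)⟩
    · rintro A A' ⟨Q, hQ0, hQ⟩ ⟨Q', hQ0', hQ'⟩
      refine ⟨Q ∪ Q', fun q hq => ?_, fun T x hx => ?_⟩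
      · exact (Finset.mem_union.1 hq).elim (hQ0 q) (hQ0' q)
      · rcases hx with hx | hx
        · obtain ⟨q, hq, H⟩ := hQ T x hx
          exact ⟨q, Finset.mem_union_left _ hq, H⟩
        · obtain ⟨q, hq, H⟩ := hQ' T x hx
          exact ⟨q, Finset.mem_union_right _ hq, H⟩
    · intro p hp
      obtain ⟨B, hpB, hp0⟩ := hS.exists_flowBox (r := r) (s := s) p
      have hpd : p ∈ B.dom := ⟨hpB, hp⟩
      have hps : p ∈ B.slice := ⟨hpd, hp0⟩
      let T₀ : LocalTransversal k l r s S := ⟨B.slice, p, FlowBox.isLocalTransversalAt hps⟩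
      have : LocallyCompactSpace B.slice := T₀.locallyCompactSpace hS
      obtain ⟨φ, hφc, hφ0, hφp⟩ := exists_continuous_nonneg_pos (⟨p, hps⟩ : B.slice)
      let π : B.dom → B.slice := fun w => ⟨B.slide 0 w, FlowBox.slide_zero_mem_slice w.2⟩
      have hπ : Continuous π :=
        ((FlowBox.continuousOn_slide_right FlowBox.zero_mem).comp_continuous
          continuous_subtype_val fun w => w.2).subtype_mk _
      have hπp : π ⟨p, hpd⟩ = ⟨p, hps⟩ := Subtype.ext (FlowBox.slide_eq_self hpd hp0)
      have hG : {w : B.dom | 0 < φ (π w)} ∈ 𝓝 (⟨p, hpd⟩ : B.dom) := by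
        refine (isOpen_lt continuous_const (φ.continuous.comp hπ)).mem_nhds ?_
        change 0 < φ (π ⟨p, hpd⟩)
        rw [hπp]
        exact (hφ0 _).lt_of_ne hφp.symm
      refine ⟨Subtype.val '' {w : B.dom | 0 < φ (π w)}, ?_, {⟨T₀, ⟨φ, hφc⟩⟩}, ?_, ?_⟩
      · have h1 : 𝓝[S] p = 𝓝[B.dom] p := by
          rw [FlowBox.dom, inter_comm, nhdsWithin_inter_of_mem']
          exact mem_nhdsWithin_of_mem_nhds (B.chart.open_source.mem_nhds hpB)
        rw [h1, nhdsWithin_eq_map_subtype_coe hpd]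
        exact image_mem_map hG
      · intro q hq
        rw [Finset.mem_singleton.1 hq]
        exact hφ0
      · rintro ⟨T, hT⟩ x ⟨w, hw, hwx⟩
        obtain ⟨B₁, hB₁⟩ := LocalTransversal.exists_eq_slice (⟨T, hT⟩ : LocalTransversal k l r s S)
        obtain rfl : T = B₁.slice := hB₁
        have hxB : (x : W) ∈ B.dom := hwx ▸ w.2
        obtain ⟨h, hh, hxh, hhx⟩ := exists_holonomyMap_slide B₁ B x hxB
        refine ⟨_, Finset.mem_singleton_self _, h, hh, hxh, ?_⟩
        have hπw : h x = π w := Subtype.ext (by rw [hhx, ← hwx])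
        change 0 < φ (h x)
        rw [hπw]
        exact hw
  obtain ⟨Q, hQ0, hQ⟩ := hind
  refine ⟨Q, hQ0, fun T x => hQ T x ?_⟩
  obtain ⟨B, hB⟩ := T.exists_eq_slice
  have hx : (x : W) ∈ B.slice := hB.le x.2
  exact hx.1.2

end Generation

end Solenoid

end

theorem mainTheorem9 (k l : ℕ) (r s : WithTop ℕ∞) (hsr : s ≤ r)
    {W : Type*} [TopologicalSpace W] [T2Space W] [ChartedSpace (Solenoid.Model k l) W]
    [Solenoid.IsFoliatedManifold k l r s W] [MeasurableSpace W] [BorelSpace W]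
    (S : Set W) (hS : Solenoid.IsPreSolenoid k l S)
    (hne : (Solenoid.transversalMeasures k l r s S).Nonempty) :
    ∃ μ ∈ Solenoid.transversalMeasures k l r s S, Solenoid.IsErgodic k l r s μ := by
  obtain ⟨ν, hνlf, hν, T, hT⟩ := hne
  have h1 (T : Solenoid.LocalTransversal k l r s S) := T.locallyCompactSpace hS
  have h2 (T : Solenoid.LocalTransversal k l r s S) := T.secondCountableTopology
  obtain ⟨Q, hQ⟩ := hS.exists_isGenerating (r := r) (s := s)
  obtain ⟨μ, hlf, hμ, hμ0, herg⟩ :=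
    Solenoid.exists_ergodic_of_isGenerating (Solenoid.isPseudogroup_holonomy S) hQ hν hT
  exact ⟨μ, ⟨hlf, hμ, hμ0⟩, fun T A hA hinv => herg T A hA hinv⟩
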